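/- Let $\mathsf{RCA}_0^\omega$ be Kohlenbach's base theory of higher-order Reverse Mathematics: classical many-sorted logic in the language of all finite types, the basic axioms of arithmetic for $0,S,+,\times,<$ on $\mathbb N$, the combinators $\Pi$ and $\Sigma$, the recursor $R_0$ of type $0$, extensionality, quantifier-free induction, and $\mathsf{QF\text{-}AC}^{1,0}$. Let $\mathsf{ACA}_0^\omega$ be $\mathsf{RCA}_0^\omega$ plus Kleene's quantifier $(\exists^2)$: there is $E:\mathbb N^{\mathbb N}\to\mathbb N$ such that $E(f)=0\leftrightarrow(\exists n\in\mathbb N)(f(n)=0)$ for all $f\in\mathbb N^{\mathbb N}$. Real numbers are given by sequences of rationals $(q_n)_{n\in\mathbb N}$ with $|q_n-q_{n+i}|<2^{-n}$ for all $n,i$; functions between sets of reals are given by functionals $\mathbb N^{\mathbb N}\to\mathbb N^{\mathbb N}$ that respect equality of reals; sets of reals are given by characteristic functions. Closures, interiors and boundaries (which need not exist as sets) are used as abbreviations. For $D=\mathbb R$ or $D=[0,1]$ and a class $\Gamma$ of functions $f:D\to\mathbb R$, the *supremum principle for $\Gamma$* states: for every $f\in\Gamma$ there is a sequence $(s_{p,q})$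 in $\mathbb R\cup\{+\infty,-\infty\}$, indexed by $p,q\in\mathbb Q\cap D$, such that $s_{p,q}=\sup_{x\in[p,q]}f(x)$ for all $p,q\in\mathbb Q\cap D$ (where $\sup\emptyset=-\infty$). $\mathsf{BOOT}$ states: for every $Y:\mathbb N^{\mathbb N}\times\mathbb N\to\mathbb N$ there is $X\subset\mathbb N$ such that $(\forall n\in\mathbb N)\big[n\in X\leftrightarrow(\exists f\in\mathbb N^{\mathbb N})(Y(f,n)=0)\big]$. For $f:D\to\mathbb R$, with all topological notions on $D$ relative to $D$, consider the following notions. 1. *Young condition*: for every $x\in D$ there are sequences in $D$ converging to $x$ strictly from the left and strictly from the right along which $f$ converges to $f(x)$ (at an end-point of $D$, only the side on which $D$ has points is considered). 2. *Almost continuity (Husain)*: for every $x\in D$ and open $G\subset\mathbb R$ with $f(x)\in G$, $\overline{f^{-1}(G)}$ is a neighbourhood of $x$. 3. *Graph continuity*: there is a continuous $g:D\to\mathbb R$ whose graph is contained in the closure of the graph of $f$. 4. *Not of Cesàro type*: there are no non-empty open $U\subset D$, $V\subset\mathbb R$ such that $U\subset\overline{f^{-1}(y)}$ for all $y\in V$.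 5. *Peripheral continuity*: for every $x\in D$ and open intervals $U\ni x$, $V\ni f(x)$ there is an open set $W\subset U\cap D$ with $x\in W$ and $f(\partial W)\subset V$. 6. *Pre-continuity*: for every open $G\subset\mathbb R$, the set $S=f^{-1}(G)$ is pre-open, i.e. $S\subset\mathrm{int}(\overline S)$. 7. *$\mathcal C$-continuity*: for every open $G\subset\mathbb R$, $f^{-1}(G)=O\cap A$ for some open $O\subset D$ and pre-open $A\subset D$. **Theorem.** The following are equivalent over $\mathsf{ACA}_0^\omega$, i.e. in each model of $\mathsf{ACA}_0^\omega$: - $\mathsf{BOOT}$; - the supremum principle for all functions $\mathbb R\to\mathbb R$; - the supremum principle for all graph continuous functions $\mathbb R\to\mathbb R$; - the supremum principle for all graph continuous functions $[0,1]\to[0,1]$; - for any one of the notions 1-7, the supremum principle for all functions $\mathbb R\to\mathbb R$ with that property; - for any one of the notions 1-7, the supremum principle for all functions $[0,1]\to\mathbb R$ with that property. -/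

import Mathlib

universe u

namespace HigherOrder

/-! ### The language of arithmetic in all finite types -/

/-- Finite types: `nat` is the type `0` of natural numbers, `arr σ τ` is the type `σ → τ`. -/
inductive FType : Type
  | nat : FType
  | arr : FType → FType → FType

infixr:60 " ⇒ " => FType.arr

/-- The type `1` of number sequences (elements of Baire space). -/
abbrev FType.one : FType := FType.nat ⇒ FType.nat

/-- The type `2` of functionals from Baire space to the natural numbers. -/
abbrev FType.two : FType := FType.one ⇒ FType.nat

open FType

/-- Terms: variables of every type, the arithmetical constants, the combinators `Π` (`combK`) and
`Σ` (`combS`), the recursor `R₀` for primitive recursion of type `0`, and application. -/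
inductive Tm : FType → Type
  | var (σ : FType) (i : ℕ) : Tm σ
  | zero : Tm nat
  | succ : Tm one
  | add : Tm (nat ⇒ nat ⇒ nat)
  | mul : Tm (nat ⇒ nat ⇒ nat)
  | combK (σ τ : FType) : Tm (σ ⇒ τ ⇒ σ)
  | combS (ρ σ τ : FType) : Tm ((ρ ⇒ σ ⇒ τ) ⇒ (ρ ⇒ σ) ⇒ ρ ⇒ τ)
  | recR : Tm (nat ⇒ nat ⇒ (nat ⇒ nat ⇒ nat) ⇒ nat)
  | app {σ τ : FType} (s : Tm (σ ⇒ τ)) (t : Tm σ) : Tm τ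

/-- Quantifier-free formulas.  The only atomic formulas are equations and inequalities of
type `0`; the terms in them may contain variables of all types. -/
inductive QFormula : Type
  | eq (s t : Tm nat) : QFormula
  | lt (s t : Tm nat) : QFormula
  | neg (A : QFormula) : QFormula
  | and (A B : QFormula) : QFormula
  | or (A B : QFormula) : QFormula
  | imp (A B : QFormula) : QFormula

/-- A many-sorted structure for the language, with one sort for each finite type. -/
structure TypeStructure : Type (u + 1) where
  El : FType → Type u
  app : {σ τ : FType} → El (σ ⇒ τ) → El σ → El τ
  zero : El nat
  succ : El one
  add : El (nat ⇒ nat ⇒ nat)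
  mul : El (nat ⇒ nat ⇒ nat)
  lt : El nat → El nat → Prop
  combK : (σ τ : FType) → El (σ ⇒ τ ⇒ σ)
  combS : (ρ σ τ : FType) → El ((ρ ⇒ σ ⇒ τ) ⇒ (ρ ⇒ σ) ⇒ ρ ⇒ τ)
  recR : El (nat ⇒ nat ⇒ (nat ⇒ nat ⇒ nat) ⇒ nat)

/-- Application in a structure. -/
def ap {M : TypeStructure.{u}} {σ τ : FType} (f : M.El (σ ⇒ τ)) (x : M.El σ) : M.El τ := M.app f x

infixl:90 " ⬝ " => ap

section Arithmetic

variable {M : TypeStructure.{u}}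

instance instZeroNat : Zero (M.El nat) := ⟨M.zero⟩
instance instOneNat : One (M.El nat) := ⟨M.succ ⬝ M.zero⟩
instance instAddNat : Add (M.El nat) := ⟨fun a b => M.add ⬝ a ⬝ b⟩
instance instMulNat : Mul (M.El nat) := ⟨fun a b => M.mul ⬝ a ⬝ b⟩
instance instLTNat : LT (M.El nat) := ⟨M.lt⟩
instance instLENat : LE (M.El nat) := ⟨fun a b => a < b ∨ a = b⟩

end Arithmetic

/-! ### The systems `RCA₀^ω` and `ACA₀^ω` -/

/-- An assignment of elements of `M` to the variables of all types. -/
abbrev Assignment (M : TypeStructure.{u}) : Type u := (σ : FType) → ℕ → M.El σ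

/-- The value of a term under an assignment. -/
def Tm.value {M : TypeStructure.{u}} (v : Assignment M) : {σ : FType} → Tm σ → M.El σ
  | _, .var σ i => v σ i
  | _, .zero => M.zero
  | _, .succ => M.succ
  | _, .add => M.add
  | _, .mul => M.mul
  | _, .combK σ τ => M.combK σ τ
  | _, .combS ρ σ τ => M.combS ρ σ τ
  | _, .recR => M.recR
  | _, .app s t => s.value v ⬝ t.value v

/-- Truth of a quantifier-free formula under an assignment. -/
def QFormula.Holds {M : TypeStructure.{u}} (v : Assignment M) : QFormula → Prop
  | .eq s t => s.value v = t.value v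
  | .lt s t => s.value v < t.value v
  | .neg A => ¬ A.Holds v
  | .and A B => A.Holds v ∧ B.Holds v
  | .or A B => A.Holds v ∨ B.Holds v
  | .imp A B => A.Holds v → B.Holds v

/-- The assignment that agrees with `v`, except that the first variable of type `0` gets the
value `n`. -/
def Assignment.setNat {M : TypeStructure.{u}} (v : Assignment M) (n : M.El nat) : Assignment M
  | .nat, 0 => n
  | σ, i => v σ i

/-- The assignment that agrees with `v`, except that the first variable of type `1` gets the
value `f`. -/
def Assignment.setOne {M : TypeStructure.{u}} (v : Assignment M) (f : M.El one) : Assignment M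
  | .arr .nat .nat, 0 => f
  | σ, i => v σ i

/-- `M` is a model of Kohlenbach's base theory `RCA₀^ω`.

Equality of functionals is by definition pointwise equality.  Together with the extensionality
axiom (pointwise equal arguments have equal values) this makes it a congruence, so that, as usual,
models are taken to be extensional: pointwise equal functionals are identified.  Quantifier-free
formulas may contain arbitrary parameters, which are supplied by the assignment `v`. -/
structure TypeStructure.IsRCA₀ω (M : TypeStructure.{u}) : Prop where
  extensionality : ∀ {σ τ : FType} (f g : M.El (σ ⇒ τ)), (∀ x, f ⬝ x = g ⬝ x) → f = g
  succ_ne_zero : ∀ n : M.El nat, M.succ ⬝ n ≠ 0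
  succ_inj : ∀ m n : M.El nat, M.succ ⬝ m = M.succ ⬝ n → m = n
  add_zero : ∀ m : M.El nat, m + 0 = m
  add_succ : ∀ m n : M.El nat, m + M.succ ⬝ n = M.succ ⬝ (m + n)
  mul_zero : ∀ m : M.El nat, m * 0 = 0
  mul_succ : ∀ m n : M.El nat, m * (M.succ ⬝ n) = m * n + m
  not_lt_zero : ∀ m : M.El nat, ¬ m < 0
  lt_succ : ∀ m n : M.El nat, m < M.succ ⬝ n ↔ m < n ∨ m = n
  combK_eq : ∀ {σ τ : FType} (x : M.El σ) (y : M.El τ), M.combK σ τ ⬝ x ⬝ y = x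
  combS_eq : ∀ {ρ σ τ : FType} (x : M.El (ρ ⇒ σ ⇒ τ)) (y : M.El (ρ ⇒ σ)) (z : M.El ρ),
    M.combS ρ σ τ ⬝ x ⬝ y ⬝ z = x ⬝ z ⬝ (y ⬝ z)
  recR_zero : ∀ (y : M.El nat) (z : M.El (nat ⇒ nat ⇒ nat)), M.recR ⬝ 0 ⬝ y ⬝ z = y
  recR_succ : ∀ (x y : M.El nat) (z : M.El (nat ⇒ nat ⇒ nat)),
    M.recR ⬝ (M.succ ⬝ x) ⬝ y ⬝ z = z ⬝ (M.recR ⬝ x ⬝ y ⬝ z) ⬝ x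
  qfInduction : ∀ (A : QFormula) (v : Assignment M),
    A.Holds (v.setNat 0) →
    (∀ n, A.Holds (v.setNat n) → A.Holds (v.setNat (M.succ ⬝ n))) →
    ∀ n, A.Holds (v.setNat n)
  qfChoice : ∀ (A : QFormula) (v : Assignment M),
    (∀ f : M.El one, ∃ n : M.El nat, A.Holds ((v.setOne f).setNat n)) →
    ∃ F : M.El two, ∀ f : M.El one, A.Holds ((v.setOne f).setNat (F ⬝ f))

/-- `M` is a model of `ACA₀^ω`, that is, of `RCA₀^ω` plus Kleene's quantifier `(∃²)`. -/
structure TypeStructure.IsACA₀ω (M : TypeStructure.{u}) : Prop extends M.IsRCA₀ω where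
  exists2 : ∃ E : M.El two, ∀ f : M.El one, E ⬝ f = 0 ↔ ∃ n, f ⬝ n = 0

/-- The principle `BOOT`: for every `Y` there is a set `X` of natural numbers, given by its
characteristic function, with `n ∈ X ↔ (∃ f) (Y (f, n) = 0)`. -/
def BOOT (M : TypeStructure.{u}) : Prop :=
  ∀ Y : M.El (one ⇒ nat ⇒ nat), ∃ X : M.El one,
    ∀ n : M.El nat, (X ⬝ n = 0 ∨ X ⬝ n = 1) ∧ (X ⬝ n = 1 ↔ ∃ f : M.El one, Y ⬝ f ⬝ n = 0)

/-! ### Rational and real numbers inside a structure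

From here on all quantifiers range over sorts of the structure `M`. -/

section Numbers

variable {M : TypeStructure.{u}}

variable (M) in
/-- The function `n ↦ 2 ^ n - 1`, by primitive recursion: the step function, built from the
combinators, is `λ a b. (a + a) + 1`. -/
def twoPowPred (n : M.El nat) : M.El nat :=
  M.recR ⬝ n ⬝ 0 ⬝
    (M.combS nat nat (nat ⇒ nat) ⬝ (M.combK (nat ⇒ nat ⇒ nat) nat ⬝ M.combK nat nat) ⬝
      (M.combS nat nat nat ⬝ (M.combK one nat ⬝ M.succ) ⬝
        (M.combS nat nat nat ⬝ M.add ⬝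
          (M.combS nat one nat ⬝ M.combK nat one ⬝ M.combK nat nat))))

theorem twoPowPred_zero (h : M.IsRCA₀ω) : twoPowPred M 0 = 0 := h.recR_zero _ _

theorem twoPowPred_succ (h : M.IsRCA₀ω) (n : M.El nat) :
    twoPowPred M (M.succ ⬝ n) = M.succ ⬝ (twoPowPred M n + twoPowPred M n) := by
  unfold twoPowPred
  rw [h.recR_succ]
  simp only [h.combS_eq, h.combK_eq]
  rfl

variable (M) in
/-- Signed fractions of natural numbers: `⟨a, b, d⟩` stands for the rational
number `(a - b) / (d + 1)`. -/
@[ext] structure Frac : Type u where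
  pos : M.El nat
  neg : M.El nat
  den : M.El nat

namespace Frac

instance : Zero (Frac M) := ⟨⟨0, 0, 0⟩⟩
instance : One (Frac M) := ⟨⟨1, 0, 0⟩⟩
instance : Add (Frac M) := ⟨fun p q =>
  ⟨p.pos * (q.den + 1) + q.pos * (p.den + 1), p.neg * (q.den + 1) + q.neg * (p.den + 1),
    p.den * q.den + p.den + q.den⟩⟩
instance : Neg (Frac M) := ⟨fun p => ⟨p.neg, p.pos, p.den⟩⟩
instance : Sub (Frac M) := ⟨fun p q => p + -q⟩
instance : LT (Frac M) := ⟨fun p q =>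
  p.pos * (q.den + 1) + q.neg * (p.den + 1) < q.pos * (p.den + 1) + p.neg * (q.den + 1)⟩

/-- `|p| < q`. -/
def AbsLT (p q : Frac M) : Prop := p < q ∧ -p < q

/-- The rational number `2 ^ (-n)`. -/
def invTwoPow (n : M.El nat) : Frac M := ⟨1, 0, twoPowPred M n⟩

/-- The (injective) pairing `(i, j) ↦ (i + j) ^ 2 + i` of natural numbers. -/
def pair (i j : M.El nat) : M.El nat := (i + j) * (i + j) + i

/-- The natural number that codes a fraction. -/
def code (p : Frac M) : M.El nat := pair (pair p.pos p.neg) p.den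

/-- The rational number `p` as a real number: the constant sequence. -/
def toReal (p : Frac M) : M.El one := M.combK nat nat ⬝ p.code

end Frac

open Frac

/-- `x` is a real number: a sequence of (codes of) rationals with `|x_n - x_(n+i)| < 2 ^ (-n)`. -/
def IsReal (x : M.El one) : Prop :=
  (∀ n, ∃ p : Frac M, x ⬝ n = p.code) ∧
  ∀ (n i : M.El nat) (p q : Frac M), x ⬝ n = p.code → x ⬝ (n + i) = q.code →
    AbsLT (p - q) (invTwoPow n)

/-- `x < y` for real numbers: `y_n - x_n > 2 * 2 ^ (-n)` for some `n`. -/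
def RLT (x y : M.El one) : Prop :=
  ∃ (n : M.El nat) (p q : Frac M), x ⬝ n = p.code ∧ y ⬝ n = q.code ∧
    p + (invTwoPow n + invTwoPow n) < q

/-- `x ≤ y` for real numbers. -/
def RLE (x y : M.El one) : Prop := ¬ RLT y x

/-- Equality of real numbers; unfolded, `|x_n - y_n| ≤ 2 * 2 ^ (-n)` for all `n`. -/
def REq (x y : M.El one) : Prop := RLE x y ∧ RLE y x

/-- `|x - y| < 2 ^ (-k)` for real numbers: `|x_n - y_n| + 2 * 2 ^ (-n) < 2 ^ (-k)` for some `n`. -/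
def Near (k : M.El nat) (x y : M.El one) : Prop :=
  ∃ (n : M.El nat) (p q : Frac M), x ⬝ n = p.code ∧ y ⬝ n = q.code ∧
    (p - q) + (invTwoPow n + invTwoPow n) < invTwoPow k ∧
    (q - p) + (invTwoPow n + invTwoPow n) < invTwoPow k

variable (M) in
/-- The real line. -/
def Line : Set (M.El one) := {x | IsReal x}

variable (M) in
/-- The unit interval. -/
def UnitInterval : Set (M.El one) :=
  {x | IsReal x ∧ RLE (Frac.toReal 0) x ∧ RLE x (Frac.toReal 1)}

/-! ### Functions, sets and topology

The domain `D` is always `Line M` or `UnitInterval M`, with the subspace topology. -/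

/-- `f` represents a function from `D` to `E`: it maps equal reals to equal reals. -/
def IsFun (D E : Set (M.El one)) (f : M.El (one ⇒ one)) : Prop :=
  (∀ x ∈ D, f ⬝ x ∈ E) ∧ ∀ x ∈ D, ∀ y ∈ D, REq x y → REq (f ⬝ x) (f ⬝ y)

/-- `A` is the characteristic function of a subset of `D`. -/
def IsSubset (D : Set (M.El one)) (A : M.El two) : Prop :=
  (∀ x ∈ D, A ⬝ x = 0 ∨ A ⬝ x = 1) ∧ ∀ x ∈ D, ∀ y ∈ D, REq x y → A ⬝ x = A ⬝ y

/-- The points of the subset of `D` with characteristic function `A`. -/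
def points (D : Set (M.El one)) (A : M.El two) : Set (M.El one) := {x | x ∈ D ∧ A ⬝ x = 1}

/-- The interior in `D` of a collection of points of `D`, which need not exist as a set in `M`. -/
def interiorIn (D S : Set (M.El one)) : Set (M.El one) :=
  {x | x ∈ D ∧ ∃ k, ∀ y ∈ D, Near k x y → y ∈ S}

/-- The closure in `D` of a collection of points of `D`, which need not exist as a set in `M`. -/
def closureIn (D S : Set (M.El one)) : Set (M.El one) :=
  {x | x ∈ D ∧ ∀ k, ∃ y ∈ D, y ∈ S ∧ Near k x y}

/-- The boundary in `D`. -/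
def boundaryIn (D S : Set (M.El one)) : Set (M.El one) := closureIn D S \ interiorIn D S

/-- `A` is the characteristic function of an open subset of `D`. -/
def IsOpenSubset (D : Set (M.El one)) (A : M.El two) : Prop :=
  IsSubset D A ∧ points D A ⊆ interiorIn D (points D A)

/-- The inverse image `f⁻¹(G)` for `f : D → ℝ` and `G ⊆ ℝ`. -/
def preimageIn (D : Set (M.El one)) (f : M.El (one ⇒ one)) (G : M.El two) : Set (M.El one) :=
  {x | x ∈ D ∧ f ⬝ x ∈ points (Line M) G}

/-- `g` represents a continuous function from `D` to the reals. -/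
def IsContinuous (D : Set (M.El one)) (g : M.El (one ⇒ one)) : Prop :=
  IsFun D (Line M) g ∧
    ∀ x ∈ D, ∀ k, ∃ N, ∀ y ∈ D, Near N x y → Near k (g ⬝ x) (g ⬝ y)

/-- The graph of `f : D → ℝ`. -/
def graphOf (D : Set (M.El one)) (f : M.El (one ⇒ one)) : Set (M.El one × M.El one) :=
  {z | z.1 ∈ D ∧ z.2 ∈ Line M ∧ REq (f ⬝ z.1) z.2}

/-- The closure in the plane. -/
def closurePlane (S : Set (M.El one × M.El one)) : Set (M.El one × M.El one) :=
  {z | z.1 ∈ Line M ∧ z.2 ∈ Line M ∧ ∀ k, ∃ w ∈ S, Near k z.1 w.1 ∧ Near k z.2 w.2}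

/-- The sequence of reals `s` converges to the real `x`. -/
def ConvergesTo (s : M.El nat → M.El one) (x : M.El one) : Prop :=
  ∀ k, ∃ N, ∀ n, N ≤ n → Near k (s n) x

/-! ### The weak continuity notions -/

/-- Graph continuity. -/
def GraphContinuous (D : Set (M.El one)) (f : M.El (one ⇒ one)) : Prop :=
  ∃ g : M.El (one ⇒ one), IsContinuous D g ∧ graphOf D g ⊆ closurePlane (graphOf D f)

/-- The Young condition.  At an end-point of `D` only the side on which `D` has points counts. -/
def YoungCondition (D : Set (M.El one)) (f : M.El (one ⇒ one)) : Prop :=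
  ∀ x ∈ D,
    ((∃ z ∈ D, RLT z x) → ∃ s : M.El (nat ⇒ one),
      (∀ n, s ⬝ n ∈ D ∧ RLT (s ⬝ n) x) ∧ ConvergesTo (fun n => s ⬝ n) x ∧
        ConvergesTo (fun n => f ⬝ (s ⬝ n)) (f ⬝ x)) ∧
    ((∃ z ∈ D, RLT x z) → ∃ s : M.El (nat ⇒ one),
      (∀ n, s ⬝ n ∈ D ∧ RLT x (s ⬝ n)) ∧ ConvergesTo (fun n => s ⬝ n) x ∧
        ConvergesTo (fun n => f ⬝ (s ⬝ n)) (f ⬝ x))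

/-- Almost continuity in the sense of Husain. -/
def HusainAlmostContinuous (D : Set (M.El one)) (f : M.El (one ⇒ one)) : Prop :=
  ∀ x ∈ D, ∀ G, IsOpenSubset (Line M) G → f ⬝ x ∈ points (Line M) G →
    x ∈ interiorIn D (closureIn D (preimageIn D f G))

/-- Functions of Cesàro type. -/
def CesaroType (D : Set (M.El one)) (f : M.El (one ⇒ one)) : Prop :=
  ∃ U V, IsOpenSubset D U ∧ (points D U).Nonempty ∧
    IsOpenSubset (Line M) V ∧ (points (Line M) V).Nonempty ∧
    ∀ y ∈ points (Line M) V, points D U ⊆ closureIn D {x | x ∈ D ∧ REq (f ⬝ x) y}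

/-- Peripheral continuity; the open intervals are `U = (a, b)` and `V = (c, d)`. -/
def PeripherallyContinuous (D : Set (M.El one)) (f : M.El (one ⇒ one)) : Prop :=
  ∀ x ∈ D, ∀ a ∈ Line M, ∀ b ∈ Line M, ∀ c ∈ Line M, ∀ d ∈ Line M,
    RLT a x → RLT x b → RLT c (f ⬝ x) → RLT (f ⬝ x) d →
    ∃ W, IsOpenSubset D W ∧ x ∈ points D W ∧
      (∀ y ∈ points D W, RLT a y ∧ RLT y b) ∧
      ∀ y ∈ boundaryIn D (points D W), RLT c (f ⬝ y) ∧ RLT (f ⬝ y) d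

/-- Pre-open collections of points of `D`. -/
def PreOpenIn (D S : Set (M.El one)) : Prop := S ⊆ interiorIn D (closureIn D S)

/-- Pre-continuity. -/
def PreContinuous (D : Set (M.El one)) (f : M.El (one ⇒ one)) : Prop :=
  ∀ G, IsOpenSubset (Line M) G → PreOpenIn D (preimageIn D f G)

/-- `𝒞`-continuity: inverse images of open sets have the form `O ∩ A` with `O` open and `A`
pre-open. -/
def CContinuous (D : Set (M.El one)) (f : M.El (one ⇒ one)) : Prop :=
  ∀ G, IsOpenSubset (Line M) G → ∃ O A, IsOpenSubset D O ∧ IsSubset D A ∧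
    PreOpenIn D (points D A) ∧ preimageIn D f G = points D O ∩ points D A

/-- Names of the seven wild weak continuity notions. -/
inductive WildNotion : Type
  | young | husain | graph | notCesaro | peripheral | pre | cContinuity

/-- The function `f : D → ℝ` has the given weak continuity property. -/
def WildNotion.Holds (D : Set (M.El one)) (f : M.El (one ⇒ one)) : WildNotion → Prop
  | .young => YoungCondition D f
  | .husain => HusainAlmostContinuous D f
  | .graph => GraphContinuous D f
  | .notCesaro => ¬ CesaroType D f
  | .peripheral => PeripherallyContinuous D f
  | .pre => PreContinuous D f
  | .cContinuity => CContinuous D f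

/-! ### Darboux's supremum principle -/

variable (M) in
/-- Extended reals: tag `0` for the real number `val`, tag `1` for `+∞`, tag `2` for `-∞`. -/
structure ExtReal : Type u where
  tag : M.El nat
  val : M.El one

/-- `e` is an extended real. -/
def ExtReal.Valid (e : ExtReal M) : Prop :=
  (e.tag = 0 ∧ IsReal e.val) ∨ e.tag = 1 ∨ e.tag = 1 + 1

/-- The order of the extended reals. -/
def ExtReal.LE (e e' : ExtReal M) : Prop :=
  e.tag = 1 + 1 ∨ e'.tag = 1 ∨ (e.tag = 0 ∧ e'.tag = 0 ∧ RLE e.val e'.val)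

/-- `e` is an upper bound of `f` on `[p, q] ∩ D`. -/
def IsUpperBound (D : Set (M.El one)) (f : M.El (one ⇒ one)) (p q : Frac M)
    (e : ExtReal M) : Prop :=
  ∀ x ∈ D, RLE p.toReal x → RLE x q.toReal → ExtReal.LE ⟨0, f ⬝ x⟩ e

/-- `e` is the supremum of `f` on `[p, q] ∩ D` in the extended reals. -/
def IsSupremum (D : Set (M.El one)) (f : M.El (one ⇒ one)) (p q : Frac M)
    (e : ExtReal M) : Prop :=
  e.Valid ∧ IsUpperBound D f p q e ∧
    ∀ e' : ExtReal M, e'.Valid → IsUpperBound D f p q e' → e.LE e'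

/-- The supremum principle for the class `Γ` of functions `f : D → ℝ`: for `f` in `Γ` there is a
sequence of extended reals, indexed by (codes of) rationals `p, q ∈ D`, whose entry at `p, q` is
the supremum of `f` on `[p, q]`. -/
def SupPrinciple (D : Set (M.El one)) (Γ : M.El (one ⇒ one) → Prop) : Prop :=
  ∀ f : M.El (one ⇒ one), IsFun D (Line M) f → Γ f →
    ∃ (t : M.El (nat ⇒ nat ⇒ nat)) (s : M.El (nat ⇒ nat ⇒ one)),
      ∀ p q : Frac M, p.toReal ∈ D → q.toReal ∈ D →
        IsSupremum D f p q ⟨t ⬝ p.code ⬝ q.code, s ⬝ p.code ⬝ q.code⟩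

end Numbers

end HigherOrder

/-!
The proof takes place inside an arbitrary model `M` of `ACA₀^ω`, whose natural numbers may be
nonstandard.

*Working inside the model.*  The classes `Rep` and `Dec` say that a function, respectively the
characteristic function of a predicate, on a product of sorts exists in `M`.  Combinatory
completeness and `(∃²)` show that arithmetical predicates with arbitrary parameters have this
property, and instance search finds these facts.  Induction and choice for arithmetical predicates
follow (`nat_induction`, `least`, `exists_seq`).  The type `0` objects of `M` form an ordered
semiring with an ordered field of fractions `RatField M`, and a real number of `M` is studied
through its Dedekind cut in this field (`cut`, `rlt_iff`, `near_iff`).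

*From `BOOT` to suprema* (`supPrinciple_of_boot`).  The set of all triples `(p, q, r)` of rationals
such that `f x > r` for some `x ∈ [p, q]` exists by `BOOT`, and all suprema are arithmetical in it.

*From suprema to `BOOT`* (`boot_of_supPrinciple`).  Given `Y`, let `f x = 1` if `x` is irrational,
lies in some strip `(1 / (n + 2), 1 / (n + 1))`, and has a rational translate that codes a sequence
`h` with `Y (h, n) = 0`; otherwise `f x = 0`.  Since every sequence is coded by an irrational number
(`exists_irrational_decode`), the supremum over the closure of the `n`-th strip is positive exactly
if `(∃ h) (Y (h, n) = 0)`.  Moreover `f` vanishes on the rationals and is invariant under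
rational translations inside each strip.  Hence around any point the level set of that point is
dense, which gives all the weak continuity notions (`IsLocallyTranslationStable.wildNotion_holds`).
One function thus serves for every class and for both domains.
-/

namespace HigherOrder

open FType

/-! ### Definability inside a model -/

section Definability

variable {M : TypeStructure.{u}}

variable (M) in
/-- `C` is a context: a finite product of sorts of `M`.  The functions from `C` to a sort `τ` that
exist in `M` are those of the form `ev F`, where `F` is an element of the curried type `fn τ`.
They contain the constant functions and are closed under pointwise application. -/
class Ctx (C : Type u) where
  fn : FType → FType
  ev : {τ : FType} → M.El (fn τ) → C → M.El τ
  const : ∀ {τ : FType} (a : M.El τ), ∃ F : M.El (fn τ), ∀ c, ev F c = a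
  app : ∀ {σ τ : FType} (F : M.El (fn (σ ⇒ τ))) (G : M.El (fn σ)),
    ∃ H : M.El (fn τ), ∀ c, ev H c = ev F c ⬝ ev G c

instance : Ctx M PUnit.{u + 1} where
  fn τ := τ
  ev F _ := F
  const a := ⟨a, fun _ => rfl⟩
  app F G := ⟨F ⬝ G, fun _ => rfl⟩

instance [hM : Fact M.IsACA₀ω] {C : Type u} [Ctx M C] {σ : FType} : Ctx M (C × M.El σ) where
  fn τ := Ctx.fn M C (σ ⇒ τ)
  ev F c := Ctx.ev F c.1 ⬝ c.2
  const {τ} a := by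
    obtain ⟨F, hF⟩ := Ctx.const (C := C) (M.combK τ σ ⬝ a)
    exact ⟨F, fun c => by rw [hF, hM.out.combK_eq]⟩
  app {ρ τ} F G := by
    obtain ⟨S, hS⟩ := Ctx.const (C := C) (M.combS σ ρ τ)
    obtain ⟨H, hH⟩ := Ctx.app S F
    obtain ⟨L, hL⟩ := Ctx.app H G
    exact ⟨L, fun c => by rw [hL, hH, hS, hM.out.combS_eq]⟩

/-- The function `φ` on the context `C` exists in `M`. -/
class Rep {C : Type u} [Ctx M C] {τ : FType} (φ : C → M.El τ) : Prop where
  out : ∃ F : M.El (Ctx.fn M C τ), ∀ c, Ctx.ev F c = φ c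

variable (M) in
/-- The predicate `P` on the context `C` has a characteristic function in `M`; the value `0`
stands for truth. -/
class Dec {C : Type u} [Ctx M C] (P : C → Prop) : Prop where
  out : ∃ φ : C → M.El nat, Rep φ ∧ ∀ c, φ c = 0 ↔ P c

variable [hM : Fact M.IsACA₀ω] {C : Type u} [Ctx M C] {ρ σ τ σ₁ σ₂ σ₃ σ₄ σ₅ σ₆ σ₇ σ₈ σ₉ : FType}

-- Closed terms are tried first: they must not be decomposed into applications.
instance (priority := 2000) Rep.const (a : M.El τ) : Rep (fun _ : C => a) := ⟨Ctx.const a⟩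

instance (priority := 900) Rep.app (s : C → M.El (σ ⇒ τ)) (t : C → M.El σ) [hs : Rep s]
    [ht : Rep t] : Rep (fun c => s c ⬝ t c) := by
  obtain ⟨F, hF⟩ := hs.out
  obtain ⟨G, hG⟩ := ht.out
  obtain ⟨H, hH⟩ := Ctx.app F G
  exact ⟨H, fun c => by rw [hH, hF, hG]⟩

/-! The following instances find the variables of a context, counted from the right. -/

instance Rep.var0 : Rep (fun c : C × M.El σ => c.2) := by
  obtain ⟨F, hF⟩ := Ctx.const (C := C)
    (M.combS σ (σ ⇒ σ) σ ⬝ M.combK σ (σ ⇒ σ) ⬝ M.combK σ σ)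
  exact ⟨F, fun c => by
    change Ctx.ev F c.1 ⬝ c.2 = c.2
    rw [hF, hM.out.combS_eq, hM.out.combK_eq]⟩

/-- Weakening: a dummy variable may be added to the context. -/
theorem Rep.weaken (φ : C → M.El τ) [h : Rep φ] : Rep (fun c : C × M.El σ => φ c.1) := by
  obtain ⟨F, hF⟩ := h.out
  obtain ⟨K, hK⟩ := Ctx.const (C := C) (M.combK τ σ)
  obtain ⟨G, hG⟩ := Ctx.app K F
  exact ⟨G, fun c => by
    change Ctx.ev G c.1 ⬝ c.2 = _
    rw [hG, hK, hM.out.combK_eq, hF]⟩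

instance Rep.var1 : Rep (fun c : (C × M.El σ) × M.El σ₁ => c.1.2) :=
  Rep.weaken (fun c : C × M.El σ => c.2)
instance Rep.var2 : Rep (fun c : ((C × M.El σ) × M.El σ₁) × M.El σ₂ => c.1.1.2) :=
  Rep.weaken (fun c : (C × M.El σ) × M.El σ₁ => c.1.2)
instance Rep.var3 : Rep (fun c : (((C × M.El σ) × M.El σ₁) × M.El σ₂) × M.El σ₃ => c.1.1.1.2) :=
  Rep.weaken (fun c : ((C × M.El σ) × M.El σ₁) × M.El σ₂ => c.1.1.2)
instance Rep.var4 : Rep (fun c : ((((C × M.El σ) × M.El σ₁) × M.El σ₂) × M.El σ₃) × M.El σ₄ =>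
    c.1.1.1.1.2) :=
  Rep.weaken (fun c : (((C × M.El σ) × M.El σ₁) × M.El σ₂) × M.El σ₃ => c.1.1.1.2)
instance Rep.var5 : Rep (fun c : (((((C × M.El σ) × M.El σ₁) × M.El σ₂) × M.El σ₃) × M.El σ₄) ×
    M.El σ₅ => c.1.1.1.1.1.2) :=
  Rep.weaken (fun c : ((((C × M.El σ) × M.El σ₁) × M.El σ₂) × M.El σ₃) × M.El σ₄ => c.1.1.1.1.2)
instance Rep.var6 : Rep (fun c : ((((((C × M.El σ) × M.El σ₁) × M.El σ₂) × M.El σ₃) × M.El σ₄) ×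
    M.El σ₅) × M.El σ₆ => c.1.1.1.1.1.1.2) :=
  Rep.weaken (fun c : (((((C × M.El σ) × M.El σ₁) × M.El σ₂) × M.El σ₃) × M.El σ₄) ×
    M.El σ₅ => c.1.1.1.1.1.2)
instance Rep.var7 : Rep (fun c : (((((((C × M.El σ) × M.El σ₁) × M.El σ₂) × M.El σ₃) × M.El σ₄) ×
    M.El σ₅) × M.El σ₆) × M.El σ₇ => c.1.1.1.1.1.1.1.2) :=
  Rep.weaken (fun c : ((((((C × M.El σ) × M.El σ₁) × M.El σ₂) × M.El σ₃) × M.El σ₄) ×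
    M.El σ₅) × M.El σ₆ => c.1.1.1.1.1.1.2)
instance Rep.var8 : Rep (fun c : ((((((((C × M.El σ) × M.El σ₁) × M.El σ₂) × M.El σ₃) × M.El σ₄) ×
    M.El σ₅) × M.El σ₆) × M.El σ₇) × M.El σ₈ => c.1.1.1.1.1.1.1.1.2) :=
  Rep.weaken (fun c : (((((((C × M.El σ) × M.El σ₁) × M.El σ₂) × M.El σ₃) × M.El σ₄) ×
    M.El σ₅) × M.El σ₆) × M.El σ₇ => c.1.1.1.1.1.1.1.2)
instance Rep.var9 : Rep (fun c : (((((((((C × M.El σ) × M.El σ₁) × M.El σ₂) × M.El σ₃) ×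
    M.El σ₄) × M.El σ₅) × M.El σ₆) × M.El σ₇) × M.El σ₈) × M.El σ₉ => c.1.1.1.1.1.1.1.1.1.2) :=
  Rep.weaken (fun c : ((((((((C × M.El σ) × M.El σ₁) × M.El σ₂) × M.El σ₃) × M.El σ₄) ×
    M.El σ₅) × M.El σ₆) × M.El σ₇) × M.El σ₈ => c.1.1.1.1.1.1.1.1.2)

instance Rep.add (s t : C → M.El nat) [Rep s] [Rep t] : Rep (fun c => s c + t c) :=
  inferInstanceAs (Rep (fun c => M.add ⬝ s c ⬝ t c))

instance Rep.mul (s t : C → M.El nat) [Rep s] [Rep t] : Rep (fun c => s c * t c) :=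
  inferInstanceAs (Rep (fun c => M.mul ⬝ s c ⬝ t c))

/-- Currying: a definable function with parameters yields a definable family of functionals. -/
theorem Rep.curry (φ : C × M.El σ → M.El τ) [h : Rep φ] :
    ∃ ψ : C → M.El (σ ⇒ τ), Rep ψ ∧ ∀ c x, ψ c ⬝ x = φ (c, x) := by
  obtain ⟨F, hF⟩ := h.out
  exact ⟨fun c => Ctx.ev (τ := σ ⇒ τ) F c, ⟨⟨F, fun _ => rfl⟩⟩, fun c x => hF (c, x)⟩

theorem exists_fun (φ : M.El σ → M.El τ) [h : Rep (fun c : PUnit.{u + 1} × M.El σ => φ c.2)] :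
    ∃ F : M.El (σ ⇒ τ), ∀ x, F ⬝ x = φ x := by
  obtain ⟨F, hF⟩ := h.out
  exact ⟨F, fun x => hF (PUnit.unit, x)⟩

theorem exists_fun₂ (φ : M.El ρ → M.El σ → M.El τ)
    [h : Rep (fun c : (PUnit.{u + 1} × M.El ρ) × M.El σ => φ c.1.2 c.2)] :
    ∃ F : M.El (ρ ⇒ σ ⇒ τ), ∀ x y, F ⬝ x ⬝ y = φ x y := by
  obtain ⟨F, hF⟩ := h.out
  exact ⟨F, fun x y => hF ((PUnit.unit, x), y)⟩

theorem exists_fun₃ {υ : FType} (φ : M.El ρ → M.El σ → M.El τ → M.El υ)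
    [h : Rep (fun c : ((PUnit.{u + 1} × M.El ρ) × M.El σ) × M.El τ => φ c.1.1.2 c.1.2 c.2)] :
    ∃ F : M.El (ρ ⇒ σ ⇒ τ ⇒ υ), ∀ x y z, F ⬝ x ⬝ y ⬝ z = φ x y z := by
  obtain ⟨F, hF⟩ := h.out
  exact ⟨F, fun x y z => hF (((PUnit.unit, x), y), z)⟩

/-! #### Characteristic functions of arithmetical predicates -/

variable (M) in
/-- A default element of each sort. -/
def dflt : (σ : FType) → M.El σ
  | nat => M.zero
  | .arr σ τ => M.combK τ σ ⬝ dflt τ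

variable (M) in
/-- The assignment of the default elements to all variables. -/
def dfltAssignment : Assignment M := fun σ _ => dflt M σ

omit hM in
theorem one_def : (1 : M.El nat) = M.succ ⬝ 0 := rfl

theorem one_ne_zero' : (1 : M.El nat) ≠ 0 := hM.out.succ_ne_zero 0

/-- Every quantifier-free formula without the first variable of type `0` has a characteristic
functional, by quantifier-free choice applied to `(A → n = 0) ∧ (¬ A → n = 1)`. -/
theorem exists_char (A : QFormula)
    (hA : ∀ (v : Assignment M) (n : M.El nat), A.Holds (v.setNat n) ↔ A.Holds v) :
    ∃ F : M.El two, ∀ f : M.El one, (F ⬝ f = 0 ↔ A.Holds ((dfltAssignment M).setOne f)) ∧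
      (F ⬝ f = 0 ∨ F ⬝ f = 1) := by
  obtain ⟨F, hF⟩ := hM.out.qfChoice
    (.and (.imp A (.eq (.var nat 0) .zero)) (.imp (.neg A) (.eq (.var nat 0) (.app .succ .zero))))
    (dfltAssignment M) (by
      intro f
      by_cases h : A.Holds ((dfltAssignment M).setOne f)
      · exact ⟨0, fun _ => rfl, fun hn => absurd ((hA _ _).2 h) hn⟩
      · exact ⟨1, fun hn => absurd ((hA _ _).1 hn) h, fun _ => rfl⟩)
  refine ⟨F, fun f => ?_⟩
  obtain ⟨h0, h1⟩ := hF f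
  simp only [QFormula.Holds, hA] at h0 h1
  change A.Holds _ → F ⬝ f = 0 at h0
  change ¬ A.Holds _ → F ⬝ f = 1 at h1
  by_cases h : A.Holds ((dfltAssignment M).setOne f)
  · exact ⟨⟨fun _ => h, h0⟩, .inl (h0 h)⟩
  · exact ⟨⟨fun e => absurd ((h1 h).symm.trans e) one_ne_zero', fun h' => absurd h' h⟩,
      .inr (h1 h)⟩

/-- The sequence `a, b, b, …`. -/
theorem exists_seq_pair : ∃ P : M.El (nat ⇒ nat ⇒ one), ∀ a b,
    P ⬝ a ⬝ b ⬝ 0 = a ∧ P ⬝ a ⬝ b ⬝ 1 = b := by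
  obtain ⟨P, hP⟩ := exists_fun₃ (M := M) (fun a b n : M.El nat =>
    M.recR ⬝ n ⬝ a ⬝ (M.combK (nat ⇒ nat) nat ⬝ (M.combK nat nat ⬝ b)))
  refine ⟨P, fun a b => ⟨?_, ?_⟩⟩
  · rw [hP, hM.out.recR_zero]
  · rw [hP, one_def, hM.out.recR_succ, hM.out.combK_eq, hM.out.combK_eq]

theorem exists_char_lt : ∃ L : M.El (nat ⇒ nat ⇒ nat), ∀ a b, L ⬝ a ⬝ b = 0 ↔ a < b := by
  obtain ⟨P, hP⟩ := exists_seq_pair (M := M)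
  obtain ⟨F, hF⟩ := exists_char (M := M) (.lt (.app (.var one 0) .zero)
    (.app (.var one 0) (.app .succ .zero))) (fun v n => Iff.rfl)
  obtain ⟨L, hL⟩ := exists_fun₂ (M := M) (fun a b : M.El nat => F ⬝ (P ⬝ a ⬝ b))
  refine ⟨L, fun a b => ?_⟩
  rw [hL, (hF _).1]
  change P ⬝ a ⬝ b ⬝ 0 < P ⬝ a ⬝ b ⬝ 1 ↔ _
  rw [(hP a b).1, (hP a b).2]

theorem exists_char_eq : ∃ L : M.El (nat ⇒ nat ⇒ nat), ∀ a b, L ⬝ a ⬝ b = 0 ↔ a = b := by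
  obtain ⟨P, hP⟩ := exists_seq_pair (M := M)
  obtain ⟨F, hF⟩ := exists_char (M := M) (.eq (.app (.var one 0) .zero)
    (.app (.var one 0) (.app .succ .zero))) (fun v n => Iff.rfl)
  obtain ⟨L, hL⟩ := exists_fun₂ (M := M) (fun a b : M.El nat => F ⬝ (P ⬝ a ⬝ b))
  refine ⟨L, fun a b => ?_⟩
  rw [hL, (hF _).1]
  change P ⬝ a ⬝ b ⬝ 0 = P ⬝ a ⬝ b ⬝ 1 ↔ _
  rw [(hP a b).1, (hP a b).2]

theorem exists_char_imp : ∃ L : M.El (nat ⇒ nat ⇒ nat), ∀ a b,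
    L ⬝ a ⬝ b = 0 ↔ (a = 0 → b = 0) := by
  obtain ⟨P, hP⟩ := exists_seq_pair (M := M)
  obtain ⟨F, hF⟩ := exists_char (M := M) (.imp (.eq (.app (.var one 0) .zero) .zero)
    (.eq (.app (.var one 0) (.app .succ .zero)) .zero)) (fun v n => Iff.rfl)
  obtain ⟨L, hL⟩ := exists_fun₂ (M := M) (fun a b : M.El nat => F ⬝ (P ⬝ a ⬝ b))
  refine ⟨L, fun a b => ?_⟩
  rw [hL, (hF _).1]
  change (P ⬝ a ⬝ b ⬝ 0 = 0 → P ⬝ a ⬝ b ⬝ 1 = 0) ↔ _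
  rw [(hP a b).1, (hP a b).2]

instance Dec.lt (s t : C → M.El nat) [Rep s] [Rep t] : Dec M (fun c => s c < t c) := by
  obtain ⟨L, hL⟩ := exists_char_lt (M := M)
  exact ⟨fun c => L ⬝ s c ⬝ t c, inferInstance, fun c => hL _ _⟩

instance Dec.eq (s t : C → M.El nat) [Rep s] [Rep t] : Dec M (fun c => s c = t c) := by
  obtain ⟨L, hL⟩ := exists_char_eq (M := M)
  exact ⟨fun c => L ⬝ s c ⬝ t c, inferInstance, fun c => hL _ _⟩

instance (priority := 2000) Dec.const (P : Prop) : Dec M (fun _ : C => P) := by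
  by_cases h : P
  · exact ⟨fun c => 0, inferInstance, fun c => by simp [h]⟩
  · exact ⟨fun c => 1, inferInstance, fun c => by simp [h, one_ne_zero']⟩

instance Dec.imp (P Q : C → Prop) [hP : Dec M P] [hQ : Dec M Q] :
    Dec M (fun c => P c → Q c) := by
  obtain ⟨φ, _, hφ⟩ := hP.out
  obtain ⟨ψ, _, hψ⟩ := hQ.out
  obtain ⟨L, hL⟩ := exists_char_imp (M := M)
  exact ⟨fun c => L ⬝ φ c ⬝ ψ c, inferInstance, fun c => by rw [hL, hφ, hψ]⟩

omit hM in
theorem Dec.congr {P Q : C → Prop} (hP : Dec M P) (h : ∀ c, P c ↔ Q c) : Dec M Q := by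
  rwa [← funext fun c => propext (h c)]

instance Dec.not (P : C → Prop) [Dec M P] : Dec M (fun c => ¬ P c) :=
  inferInstanceAs (Dec M (fun c => P c → False))

instance Dec.and (P Q : C → Prop) [Dec M P] [Dec M Q] : Dec M (fun c => P c ∧ Q c) :=
  Dec.congr (P := fun c => ¬ (P c → ¬ Q c)) inferInstance (by simp)

instance Dec.or (P Q : C → Prop) [Dec M P] [Dec M Q] : Dec M (fun c => P c ∨ Q c) :=
  Dec.congr (P := fun c => ¬ P c → Q c) inferInstance (fun c => by tauto)

instance Dec.iff (P Q : C → Prop) [Dec M P] [Dec M Q] : Dec M (fun c => P c ↔ Q c) :=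
  Dec.congr (P := fun c => (P c → Q c) ∧ (Q c → P c)) inferInstance (fun c => by tauto)

/-- Closure under number quantifiers is Kleene's `∃²`. -/
instance Dec.ex (P : C → M.El nat → Prop) [h : Dec M (fun c : C × M.El nat => P c.1 c.2)] :
    Dec M (fun c => ∃ n, P c n) := by
  obtain ⟨φ, _, hφ⟩ := h.out
  obtain ⟨ψ, _, hψ⟩ := Rep.curry φ
  obtain ⟨E, hE⟩ := hM.out.exists2
  exact ⟨fun c => E ⬝ ψ c, inferInstance, fun c => by simp only [hE, hψ, hφ]⟩

instance Dec.all (P : C → M.El nat → Prop) [Dec M (fun c : C × M.El nat => P c.1 c.2)] :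
    Dec M (fun c => ∀ n, P c n) :=
  Dec.congr (P := fun c => ¬ ∃ n, ¬ P c n) inferInstance (by simp)

instance Dec.le (s t : C → M.El nat) [Rep s] [Rep t] : Dec M (fun c => s c ≤ t c) :=
  inferInstanceAs (Dec M (fun c => s c < t c ∨ s c = t c))

/-- Arithmetical predicates with arbitrary parameters have characteristic functions. -/
theorem exists_decider (P : M.El σ → Prop) [h : Dec M (fun c : PUnit.{u + 1} × M.El σ => P c.2)] :
    ∃ F : M.El (σ ⇒ nat), ∀ x, F ⬝ x = 0 ↔ P x := by
  obtain ⟨φ, _, hφ⟩ := h.out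
  obtain ⟨F, hF⟩ := exists_fun (fun x => φ (PUnit.unit, x)) (h := by assumption)
  exact ⟨F, fun x => by rw [hF, hφ]⟩

theorem exists_decider₂ (P : M.El ρ → M.El σ → Prop)
    [h : Dec M (fun c : (PUnit.{u + 1} × M.El ρ) × M.El σ => P c.1.2 c.2)] :
    ∃ F : M.El (ρ ⇒ σ ⇒ nat), ∀ x y, F ⬝ x ⬝ y = 0 ↔ P x y := by
  obtain ⟨φ, _, hφ⟩ := h.out
  obtain ⟨F, hF⟩ := exists_fun₂ (fun x y => φ ((PUnit.unit, x), y)) (h := by assumption)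
  exact ⟨F, fun x y => by rw [hF, hφ]⟩

/-- Arithmetical induction: quantifier-free induction, applied to a characteristic function. -/
theorem arith_induction (P : M.El nat → Prop)
    [h : Dec M (fun c : PUnit.{u + 1} × M.El nat => P c.2)]
    (zero : P 0) (succ : ∀ n, P n → P (M.succ ⬝ n)) (n : M.El nat) : P n := by
  obtain ⟨F, hF⟩ := exists_decider P
  refine (hF n).1 (hM.out.qfInduction (.eq (.app (.var one 0) (.var nat 0)) .zero)
    ((dfltAssignment M).setOne F) ((hF 0).2 zero) (fun n hn => (hF _).2 (succ n ?_)) n)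
  exact (hF n).1 hn

end Definability

/-! ### The natural numbers of a model -/

section NaturalNumbers

variable {M : TypeStructure.{u}} [hM : Fact M.IsACA₀ω]

theorem succ_eq (n : M.El nat) : M.succ ⬝ n = n + 1 := by
  rw [one_def, hM.out.add_succ, hM.out.add_zero]

/-- Arithmetical induction, with the successor written as `n + 1`. -/
theorem nat_induction (P : M.El nat → Prop) [h : Dec M (fun c : PUnit.{u + 1} × M.El nat => P c.2)]
    (zero : P 0) (succ : ∀ n, P n → P (n + 1)) (n : M.El nat) : P n :=
  arith_induction P zero (fun n hn => by rw [succ_eq]; exact succ n hn) n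

namespace NatModel

theorem add_zero (a : M.El nat) : a + 0 = a := hM.out.add_zero a
theorem add_succ (a b : M.El nat) : a + (b + 1) = a + b + 1 := by
  rw [← succ_eq, ← succ_eq, hM.out.add_succ]
theorem mul_zero (a : M.El nat) : a * 0 = 0 := hM.out.mul_zero a
theorem mul_succ (a b : M.El nat) : a * (b + 1) = a * b + a := by
  rw [← succ_eq, hM.out.mul_succ]
theorem succ_ne_zero (a : M.El nat) : a + 1 ≠ 0 := by
  rw [← succ_eq]; exact hM.out.succ_ne_zero a
theorem succ_inj (a b : M.El nat) (h : a + 1 = b + 1) : a = b := by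
  rw [← succ_eq, ← succ_eq] at h; exact hM.out.succ_inj a b h
theorem lt_succ (a b : M.El nat) : a < b + 1 ↔ a < b ∨ a = b := by
  rw [← succ_eq]; exact hM.out.lt_succ a b

theorem zero_add (a : M.El nat) : 0 + a = a :=
  nat_induction (fun a : M.El nat => 0 + a = a) (add_zero 0)
    (fun n hn => by rw [add_succ, hn]) a

theorem succ_add (a b : M.El nat) : a + 1 + b = a + b + 1 :=
  nat_induction (fun b : M.El nat => a + 1 + b = a + b + 1) (by rw [add_zero, add_zero])
    (fun n hn => by rw [add_succ, hn, add_succ]) b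

theorem add_comm (a b : M.El nat) : a + b = b + a :=
  nat_induction (fun b : M.El nat => a + b = b + a) (by rw [add_zero, zero_add])
    (fun n hn => by rw [add_succ, hn, succ_add]) b

theorem add_assoc (a b c : M.El nat) : a + b + c = a + (b + c) :=
  nat_induction (fun c : M.El nat => a + b + c = a + (b + c)) (by rw [add_zero, add_zero])
    (fun n hn => by rw [add_succ, hn, add_succ, add_succ]) c

theorem zero_mul (a : M.El nat) : 0 * a = 0 :=
  nat_induction (fun a : M.El nat => 0 * a = 0) (mul_zero 0)
    (fun n hn => by rw [mul_succ, hn, add_zero]) a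

theorem succ_mul (a b : M.El nat) : (a + 1) * b = a * b + b :=
  nat_induction (fun b : M.El nat => (a + 1) * b = a * b + b)
    (by rw [mul_zero, mul_zero, add_zero])
    (fun n hn => by
      rw [mul_succ, hn, mul_succ, add_succ, add_succ, add_assoc (a * n), add_comm n a,
        ← add_assoc]) b

theorem mul_comm (a b : M.El nat) : a * b = b * a :=
  nat_induction (fun b : M.El nat => a * b = b * a) (by rw [mul_zero, zero_mul])
    (fun n hn => by rw [mul_succ, hn, succ_mul]) b

theorem mul_add (a b c : M.El nat) : a * (b + c) = a * b + a * c :=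
  nat_induction (fun c : M.El nat => a * (b + c) = a * b + a * c)
    (by rw [add_zero, mul_zero, add_zero])
    (fun n hn => by rw [add_succ, mul_succ, hn, mul_succ, add_assoc]) c

theorem mul_assoc (a b c : M.El nat) : a * b * c = a * (b * c) :=
  nat_induction (fun c : M.El nat => a * b * c = a * (b * c))
    (by rw [mul_zero, mul_zero, mul_zero])
    (fun n hn => by rw [mul_succ, hn, mul_succ, mul_add]) c

theorem one_mul (a : M.El nat) : 1 * a = a := by
  rw [← zero_add 1, succ_mul, zero_mul, zero_add]

end NatModel

instance : CommSemiring (M.El nat) where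
  add_assoc := NatModel.add_assoc
  zero_add := NatModel.zero_add
  add_zero := NatModel.add_zero
  add_comm := NatModel.add_comm
  nsmul := nsmulRec
  left_distrib := NatModel.mul_add
  right_distrib a b c := by
    rw [NatModel.mul_comm, NatModel.mul_add, NatModel.mul_comm c, NatModel.mul_comm c]
  zero_mul := NatModel.zero_mul
  mul_zero := NatModel.mul_zero
  mul_assoc := NatModel.mul_assoc
  one_mul := NatModel.one_mul
  mul_one a := by rw [NatModel.mul_comm, NatModel.one_mul]
  mul_comm := NatModel.mul_comm

theorem nat_cases (a : M.El nat) : a = 0 ∨ ∃ b, a = b + 1 :=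
  nat_induction (fun a : M.El nat => a = 0 ∨ ∃ b, a = b + 1) (.inl rfl)
    (fun n _ => .inr ⟨n, rfl⟩) a

instance : IsCancelAdd (M.El nat) :=
  have key (a b c : M.El nat) : a + c = b + c → a = b :=
    nat_induction (fun c : M.El nat => a + c = b + c → a = b) (by simp)
      (fun n hn h => hn (NatModel.succ_inj _ _ (by rwa [add_assoc, add_assoc]))) c
  { add_right_cancel := fun a b c h => key b c a h
    add_left_cancel := fun a b c h => key b c a (by simpa only [add_comm a] using h) }

/-- The axioms of the order determine it in terms of addition. -/
theorem nat_lt_iff (a b : M.El nat) : a < b ↔ ∃ k, a + (k + 1) = b :=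
  nat_induction (fun b : M.El nat => a < b ↔ ∃ k, a + (k + 1) = b)
    ⟨fun h => absurd h (hM.out.not_lt_zero a), fun ⟨k, hk⟩ => by
      rw [← add_assoc] at hk; exact absurd hk (NatModel.succ_ne_zero _)⟩
    (fun n hn => by
      rw [NatModel.lt_succ, hn]
      constructor
      · rintro (⟨k, rfl⟩ | rfl)
        · exact ⟨k + 1, by ring⟩
        · exact ⟨0, by ring⟩
      · rintro ⟨k, hk⟩
        rw [← add_assoc] at hk
        have := NatModel.succ_inj _ _ hk
        obtain rfl | ⟨l, rfl⟩ := nat_cases k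
        · exact .inr (by simpa using this)
        · exact .inl ⟨l, this⟩) b

theorem nat_le_iff (a b : M.El nat) : a ≤ b ↔ ∃ k, b = a + k := by
  change a < b ∨ a = b ↔ _
  rw [nat_lt_iff]
  constructor
  · rintro (⟨k, rfl⟩ | rfl)
    · exact ⟨k + 1, rfl⟩
    · exact ⟨0, by simp⟩
  · rintro ⟨k, rfl⟩
    obtain rfl | ⟨l, rfl⟩ := nat_cases k
    · exact .inr (by simp)
    · exact .inl ⟨l, rfl⟩

theorem nat_add_eq_zero (a b : M.El nat) (h : a + b = 0) : a = 0 := by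
  obtain rfl | ⟨l, rfl⟩ := nat_cases b
  · simpa using h
  · rw [← add_assoc] at h
    exact absurd h (NatModel.succ_ne_zero _)

noncomputable instance : LinearOrder (M.El nat) where
  le_refl a := .inr rfl
  le_trans a b c := by
    simp only [nat_le_iff]
    rintro ⟨k, rfl⟩ ⟨l, rfl⟩
    exact ⟨k + l, by ring⟩
  le_antisymm a b := by
    simp only [nat_le_iff]
    rintro ⟨k, rfl⟩ ⟨l, hl⟩
    have : k + l = 0 := add_left_cancel (a := a) (by rw [← add_assoc, ← hl, add_zero])
    rw [nat_add_eq_zero _ _ this, add_zero]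
  lt_iff_le_not_ge a b := by
    rw [nat_lt_iff, nat_le_iff, nat_le_iff]
    constructor
    · rintro ⟨k, rfl⟩
      refine ⟨⟨k + 1, rfl⟩, ?_⟩
      rintro ⟨l, hl⟩
      have : (k + l) + 1 = 0 := add_left_cancel (a := a) (by rw [add_zero]; nth_rw 2 [hl]; ring)
      exact NatModel.succ_ne_zero _ this
    · rintro ⟨⟨k, rfl⟩, h⟩
      obtain rfl | ⟨l, rfl⟩ := nat_cases k
      · exact absurd ⟨0, by simp⟩ h
      · exact ⟨l, rfl⟩
  le_total a b := by
    refine nat_induction (fun b : M.El nat => a ≤ b ∨ b ≤ a) (.inr ?_) (fun n hn => ?_) b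
    · exact (nat_le_iff _ _).2 ⟨a, by simp⟩
    · simp only [nat_le_iff] at hn ⊢
      rcases hn with ⟨k, rfl⟩ | ⟨k, rfl⟩
      · exact .inl ⟨k + 1, by ring⟩
      · obtain rfl | ⟨l, rfl⟩ := nat_cases k
        · exact .inl ⟨1, by simp⟩
        · exact .inr ⟨l, by ring⟩
  toDecidableLE := Classical.decRel _

instance : Nontrivial (M.El nat) := ⟨⟨1, 0, one_ne_zero'⟩⟩

instance : CanonicallyOrderedAdd (M.El nat) where
  le_self_add a b := (nat_le_iff _ _).2 ⟨b, rfl⟩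
  le_add_self a b := (nat_le_iff _ _).2 ⟨b, by ring⟩
  exists_add_of_le h := (nat_le_iff _ _).1 h

instance : IsOrderedCancelAddMonoid (M.El nat) where
  add_le_add_left a b h c := by
    obtain ⟨k, rfl⟩ := (nat_le_iff _ _).1 h
    exact (nat_le_iff _ _).2 ⟨k, by ring⟩
  le_of_add_le_add_left a b c h := by
    obtain ⟨k, hk⟩ := (nat_le_iff _ _).1 h
    exact (nat_le_iff _ _).2 ⟨k, add_left_cancel (a := a) (by rw [hk]; ring)⟩

theorem nat_mul_lt {a b c : M.El nat} (h : a < b) (hc : 0 < c) : c * a < c * b := by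
  obtain ⟨k, rfl⟩ := (nat_lt_iff _ _).1 h
  obtain ⟨l, rfl⟩ := (nat_lt_iff _ _).1 hc
  exact (nat_lt_iff _ _).2 ⟨l * k + l + k, by ring⟩

instance : IsStrictOrderedRing (M.El nat) where
  zero_le_one := zero_le
  le_of_add_le_add_left a b c h := le_of_add_le_add_left h
  mul_lt_mul_of_pos_left c hc a b h := nat_mul_lt h hc
  mul_lt_mul_of_pos_right c hc a b h := by
    simpa only [mul_comm] using nat_mul_lt h hc

theorem nat_lt_add_one (a b : M.El nat) : a < b + 1 ↔ a ≤ b := NatModel.lt_succ a b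

theorem nat_add_one_le (a b : M.El nat) : a + 1 ≤ b ↔ a < b := by
  rw [← nat_lt_add_one, add_lt_add_iff_right]

end NaturalNumbers

/-! ### The ordered field of fractions of an ordered semiring -/

section Differences

variable (N : Type u) [CommSemiring N] [IsCancelAdd N]

/-- Two pairs represent the same formal difference. -/
def diffSetoid : Setoid (N × N) where
  r a b := a.1 + b.2 = b.1 + a.2
  iseqv :=
    { refl := fun _ => rfl
      symm := fun h => h.symm
      trans := fun h₁ h₂ => by grind }

/-- The ring of formal differences of elements of a cancellative commutative semiring. -/
def Diff : Type u := Quotient (diffSetoid N)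

variable {N}

namespace Diff

/-- The difference `a - b`. -/
def mk (a b : N) : Diff N := Quotient.mk (diffSetoid N) (a, b)

theorem mk_eq_iff {a b c d : N} : mk a b = mk c d ↔ a + d = c + b :=
  Quotient.eq (r := diffSetoid N)

theorem ind {P : Diff N → Prop} (h : ∀ a b, P (mk a b)) (x : Diff N) : P x :=
  Quotient.inductionOn x fun p => h p.1 p.2

instance : Zero (Diff N) := ⟨mk 0 0⟩
instance : One (Diff N) := ⟨mk 1 0⟩
instance : Add (Diff N) := ⟨Quotient.map₂ (fun p q => (p.1 + q.1, p.2 + q.2)) (by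
  intro a b (h₁ : _ = _) c d (h₂ : _ = _)
  change a.1 + c.1 + (b.2 + d.2) = b.1 + d.1 + (a.2 + c.2)
  grind)⟩
instance : Neg (Diff N) := ⟨Quotient.map (fun p => (p.2, p.1)) (by
  intro a b (h : _ = _)
  change a.2 + b.1 = b.2 + a.1
  grind)⟩
instance : Mul (Diff N) :=
  ⟨Quotient.map₂ (fun p q => (p.1 * q.1 + p.2 * q.2, p.1 * q.2 + p.2 * q.1)) (by
    intro a b (h₁ : _ = _) c d (h₂ : _ = _)
    change a.1 * c.1 + a.2 * c.2 + (b.1 * d.2 + b.2 * d.1) =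
      b.1 * d.1 + b.2 * d.2 + (a.1 * c.2 + a.2 * c.1)
    grind)⟩

theorem zero_def : (0 : Diff N) = mk 0 0 := rfl
theorem one_def : (1 : Diff N) = mk 1 0 := rfl
theorem mk_add (a b c d : N) : mk a b + mk c d = mk (a + c) (b + d) := rfl
theorem mk_mul (a b c d : N) : mk a b * mk c d = mk (a * c + b * d) (a * d + b * c) := rfl
theorem neg_mk (a b : N) : -mk a b = mk b a := rfl

instance : CommRing (Diff N) where
  add_assoc x y z := by
    induction x using ind; induction y using ind; induction z using ind
    simp only [mk_add, mk_eq_iff]; ring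
  zero_add x := by
    induction x using ind
    simp only [zero_def, mk_add, mk_eq_iff]; ring
  add_zero x := by
    induction x using ind
    simp only [zero_def, mk_add, mk_eq_iff]; ring
  add_comm x y := by
    induction x using ind; induction y using ind
    simp only [mk_add, mk_eq_iff]; ring
  neg_add_cancel x := by
    induction x using ind
    simp only [zero_def, neg_mk, mk_add, mk_eq_iff]; ring
  left_distrib x y z := by
    induction x using ind; induction y using ind; induction z using ind
    simp only [mk_add, mk_mul, mk_eq_iff]; ring
  right_distrib x y z := by
    induction x using ind; induction y using ind; induction z using ind
    simp only [mk_add, mk_mul, mk_eq_iff]; ring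
  zero_mul x := by
    induction x using ind
    simp only [zero_def, mk_mul, mk_eq_iff]; ring
  mul_zero x := by
    induction x using ind
    simp only [zero_def, mk_mul, mk_eq_iff]; ring
  mul_assoc x y z := by
    induction x using ind; induction y using ind; induction z using ind
    simp only [mk_mul, mk_eq_iff]; ring
  one_mul x := by
    induction x using ind
    simp only [one_def, mk_mul, mk_eq_iff]; ring
  mul_one x := by
    induction x using ind
    simp only [one_def, mk_mul, mk_eq_iff]; ring
  mul_comm x y := by
    induction x using ind; induction y using ind
    simp only [mk_mul, mk_eq_iff]; ring
  nsmul := nsmulRec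
  zsmul := zsmulRec

/-- The embedding of the semiring into its ring of differences. -/
def of : N →+* Diff N where
  toFun a := mk a 0
  map_zero' := rfl
  map_one' := rfl
  map_add' a b := by rw [mk_add, mk_eq_iff]; ring
  map_mul' a b := by rw [mk_mul, mk_eq_iff]; ring

theorem of_injective : Function.Injective (of : N → Diff N) := fun a b h => by
  simpa using mk_eq_iff.1 h

theorem exists_eq_sub (x : Diff N) : ∃ a b : N, x = of a - of b := by
  induction x using ind with
  | h a b =>
    refine ⟨a, b, ?_⟩
    rw [sub_eq_add_neg]
    change mk a b = mk a 0 + -mk b 0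
    rw [neg_mk, mk_add, mk_eq_iff]; ring

end Diff

end Differences

section FractionField

variable (N : Type u) [CommSemiring N] [LinearOrder N] [IsStrictOrderedRing N]
  [CanonicallyOrderedAdd N]

instance : Nontrivial (Diff N) := Diff.of_injective.nontrivial

/-- Every formal difference is, up to sign, an element of the semiring. -/
theorem Diff.eq_or_eq_neg (x : Diff N) : ∃ a : N, x = Diff.of a ∨ x = -Diff.of a := by
  obtain ⟨a, b, rfl⟩ := x.exists_eq_sub
  rcases le_total a b with h | h
  · obtain ⟨k, rfl⟩ := exists_add_of_le h
    exact ⟨k, .inr (by rw [map_add]; ring)⟩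
  · obtain ⟨k, rfl⟩ := exists_add_of_le h
    exact ⟨k, .inl (by rw [map_add]; ring)⟩

instance : NoZeroDivisors (Diff N) where
  eq_zero_or_eq_zero_of_mul_eq_zero {x y} h := by
    obtain ⟨a, ha⟩ := Diff.eq_or_eq_neg N x
    obtain ⟨b, hb⟩ := Diff.eq_or_eq_neg N y
    have : Diff.of (a * b) = 0 := by
      rw [map_mul]
      rcases ha with rfl | rfl <;> rcases hb with rfl | rfl <;> simpa using h
    rw [← map_zero Diff.of] at this
    rcases mul_eq_zero.1 (Diff.of_injective this) with rfl | rfl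
    · left; simpa using ha
    · right; simpa using hb

instance : IsDomain (Diff N) := NoZeroDivisors.to_isDomain _

/-- The field of fractions of an ordered semiring. -/
def FracField : Type u := FractionRing (Diff N)

noncomputable instance : Field (FracField N) := inferInstanceAs (Field (FractionRing (Diff N)))
noncomputable instance : Algebra (Diff N) (FracField N) :=
  inferInstanceAs (Algebra (Diff N) (FractionRing (Diff N)))
instance : IsFractionRing (Diff N) (FracField N) :=
  inferInstanceAs (IsFractionRing (Diff N) (FractionRing (Diff N)))

variable {N}

/-- The embedding of an ordered semiring into its field of fractions. -/
noncomputable def toField : N →+* FracField N :=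
  (algebraMap (Diff N) (FracField N)).comp Diff.of

theorem toField_injective : Function.Injective (toField : N → FracField N) :=
  (IsFractionRing.injective (Diff N) (FracField N)).comp Diff.of_injective

theorem toField_ne_zero {a : N} (h : 0 < a) : toField a ≠ 0 := fun e =>
  h.ne' (toField_injective (by rw [e, map_zero]))

theorem FracField.eq_or_eq_neg (x : FracField N) :
    ∃ a b : N, 0 < b ∧ (x = toField a / toField b ∨ x = -(toField a / toField b)) := by
  obtain ⟨z, w, hw, rfl⟩ := IsFractionRing.div_surjective (Diff N) x
  obtain ⟨a, ha⟩ := Diff.eq_or_eq_neg N z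
  obtain ⟨b, hb⟩ := Diff.eq_or_eq_neg N w
  refine ⟨a, b, pos_iff_ne_zero.2 ?_, ?_⟩
  · rintro rfl
    exact nonZeroDivisors.ne_zero hw (by simpa using hb)
  · change _ = algebraMap _ (FracField N) (Diff.of a) / algebraMap _ (FracField N) (Diff.of b) ∨
      _ = -(algebraMap _ (FracField N) (Diff.of a) / algebraMap _ (FracField N) (Diff.of b))
    rcases ha with rfl | rfl <;> rcases hb with rfl | rfl
    · left; rfl
    · right; rw [map_neg, div_neg]
    · right; rw [map_neg, neg_div]
    · left; rw [map_neg, map_neg, neg_div_neg_eq]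

variable (N) in
/-- The cone of the elements `a / b` with `a` and `b` in the semiring. -/
noncomputable def fracCone : RingCone (FracField N) where
  carrier := {x | ∃ a b : N, 0 < b ∧ x = toField a / toField b}
  mul_mem' := by
    rintro _ _ ⟨a, b, hb, rfl⟩ ⟨c, d, hd, rfl⟩
    exact ⟨a * c, b * d, mul_pos hb hd, by rw [map_mul, map_mul, div_mul_div_comm]⟩
  one_mem' := ⟨1, 1, one_pos, by simp⟩
  add_mem' := by
    rintro _ _ ⟨a, b, hb, rfl⟩ ⟨c, d, hd, rfl⟩
    refine ⟨a * d + b * c, b * d, mul_pos hb hd, ?_⟩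
    rw [div_add_div _ _ (toField_ne_zero hb) (toField_ne_zero hd)]
    simp only [map_mul, map_add]
  zero_mem' := ⟨0, 1, one_pos, by simp⟩
  eq_zero_of_mem_of_neg_mem' := by
    rintro x ⟨a, b, hb, rfl⟩ ⟨c, d, hd, h⟩
    have hb' := toField_ne_zero hb
    have hd' := toField_ne_zero hd
    have : toField (a * d + c * b) = toField 0 := by
      rw [map_zero, map_add, map_mul, map_mul]
      field_simp at h
      linear_combination -h
    have h0 := add_eq_zero.1 (toField_injective this)
    rw [(mul_eq_zero.1 h0.1).resolve_right hd.ne', map_zero, zero_div]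

open Classical in
noncomputable instance : LinearOrder (FracField N) :=
  haveI : HasMemOrNegMem (fracCone N) := ⟨fun x => by
    obtain ⟨a, b, hb, h | h⟩ := x.eq_or_eq_neg
    · exact .inl ⟨a, b, hb, h⟩
    · exact .inr ⟨a, b, hb, by rw [h, neg_neg]⟩⟩
  LinearOrder.mkOfAddGroupCone (fracCone N)

instance : IsOrderedRing (FracField N) := IsOrderedRing.mkOfCone (fracCone N)

instance : IsStrictOrderedRing (FracField N) := IsOrderedRing.toIsStrictOrderedRing _

theorem toField_nonneg (a : N) : 0 ≤ toField a := by
  change toField a - 0 ∈ fracCone N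
  exact ⟨a, 1, one_pos, by simp⟩

theorem toField_strictMono : StrictMono (toField : N → FracField N) := by
  refine Monotone.strictMono_of_injective (fun a b h => ?_) toField_injective
  obtain ⟨k, rfl⟩ := exists_add_of_le h
  rw [map_add]
  exact le_add_of_nonneg_right (toField_nonneg k)

theorem toField_le {a b : N} : toField a ≤ toField b ↔ a ≤ b := toField_strictMono.le_iff_le
theorem toField_lt {a b : N} : toField a < toField b ↔ a < b := toField_strictMono.lt_iff_lt

end FractionField

/-! ### Rational numbers of a model -/

section Rationals

variable {M : TypeStructure.{u}} [hM : Fact M.IsACA₀ω]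

variable (M) in
/-- The ordered field of the rational numbers of `M`. -/
abbrev RatField : Type u := FracField (M.El nat)

theorem nat_mul_self_lt {a b : M.El nat} (h : a < b) : a * a + a < b * b := by
  obtain ⟨k, rfl⟩ := (nat_lt_iff _ _).1 h
  exact (nat_lt_iff _ _).2 ⟨2 * a * k + a + k * k + 2 * k, by ring⟩

namespace Frac

theorem pair_lt {a b c d : M.El nat} (h : a + b < c + d) : pair a b < pair c d :=
  calc (a + b) * (a + b) + a ≤ (a + b) * (a + b) + (a + b) := by gcongr; exact le_self_add
    _ < (c + d) * (c + d) := nat_mul_self_lt h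
    _ ≤ (c + d) * (c + d) + c := le_self_add

theorem pair_inj {a b c d : M.El nat} (h : pair a b = pair c d) : a = c ∧ b = d := by
  rcases lt_trichotomy (a + b) (c + d) with h' | h' | h'
  · exact absurd h (pair_lt h').ne
  · have : a = c := by
      unfold pair at h
      rw [h'] at h
      exact add_left_cancel h
    subst this
    exact ⟨rfl, add_left_cancel h'⟩
  · exact absurd h (pair_lt h').ne'

theorem code_injective : Function.Injective (code : Frac M → M.El nat) := fun p q h => by
  obtain ⟨h₁, h₂⟩ := pair_inj h
  obtain ⟨h₃, h₄⟩ := pair_inj h₁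
  exact Frac.ext h₃ h₄ h₂

/-- The rational number represented by a fraction. -/
noncomputable def val (p : Frac M) : RatField M :=
  (toField p.pos - toField p.neg) / (toField p.den + 1)

theorem den_pos (p : Frac M) : 0 < toField p.den + 1 :=
  lt_of_lt_of_le one_pos (le_add_of_nonneg_left (toField_nonneg _))

theorem val_zero : val (0 : Frac M) = 0 := by
  change (toField 0 - toField 0) / (toField 0 + 1) = (0 : RatField M)
  simp

theorem val_one : val (1 : Frac M) = 1 := by
  change (toField 1 - toField 0) / (toField 0 + 1) = (1 : RatField M)
  simp

theorem val_add (p q : Frac M) : val (p + q) = val p + val q := by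
  have hp := (den_pos p).ne'
  have hq := (den_pos q).ne'
  change (toField (p.pos * (q.den + 1) + q.pos * (p.den + 1)) -
    toField (p.neg * (q.den + 1) + q.neg * (p.den + 1))) /
    (toField (p.den * q.den + p.den + q.den) + 1) = _
  have : toField (p.den * q.den + p.den + q.den) + 1 =
      (toField p.den + 1) * (toField q.den + 1) := by
    simp only [map_add, map_mul]; ring
  rw [this]
  unfold val
  simp only [map_add, map_mul, map_one]
  field_simp
  ring

theorem val_neg (p : Frac M) : val (-p) = -val p := by
  change (toField p.neg - toField p.pos) / (toField p.den + 1) = _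
  unfold val
  ring

theorem val_sub (p q : Frac M) : val (p - q) = val p - val q := by
  change val (p + -q) = _
  rw [val_add, val_neg, sub_eq_add_neg]

theorem lt_iff (p q : Frac M) : p < q ↔ val p < val q := by
  change p.pos * (q.den + 1) + q.neg * (p.den + 1) <
    q.pos * (p.den + 1) + p.neg * (q.den + 1) ↔ _
  rw [← toField_lt, val, val, div_lt_div_iff₀ (den_pos p) (den_pos q)]
  simp only [map_add, map_mul, map_one]
  constructor <;> intro h <;> linarith

theorem absLT_iff (p q : Frac M) : AbsLT p q ↔ |val p| < val q := by
  rw [AbsLT, lt_iff, lt_iff, val_neg, abs_lt]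
  constructor <;> rintro ⟨h₁, h₂⟩ <;> constructor <;> linarith

theorem exists_val (z : RatField M) : ∃ p : Frac M, val p = z := by
  obtain ⟨a, b, hb, h⟩ := z.eq_or_eq_neg
  obtain ⟨k, rfl⟩ := (nat_lt_iff _ _).1 hb
  rcases h with rfl | rfl
  · exact ⟨⟨a, 0, k⟩, by simp [val]⟩
  · exact ⟨⟨0, a, k⟩, by simp [val, neg_div]⟩

end Frac

open Frac

/-! ### Powers of two -/

/-- The rational number `2 ^ (-n)`. -/
noncomputable def wt (n : M.El nat) : RatField M := val (invTwoPow n)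

theorem wt_eq (n : M.El nat) : wt n = (toField (twoPowPred M n) + 1)⁻¹ := by
  change (toField 1 - toField 0) / _ = _
  rw [map_one, map_zero, sub_zero, one_div]
  rfl

theorem wt_pos (n : M.El nat) : 0 < wt n := by
  rw [wt_eq]
  exact inv_pos.2 (den_pos (invTwoPow n))

theorem wt_zero : wt (0 : M.El nat) = 1 := by
  rw [wt_eq, twoPowPred_zero hM.out.toIsRCA₀ω, map_zero]
  simp

theorem wt_succ (n : M.El nat) : wt (n + 1) = wt n / 2 := by
  rw [wt_eq, wt_eq, ← succ_eq, twoPowPred_succ hM.out.toIsRCA₀ω, succ_eq]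
  have : toField (twoPowPred M n + twoPowPred M n + 1) + 1 =
      (toField (twoPowPred M n) + 1) * 2 := by
    simp only [map_add, map_one]; ring
  rw [this, mul_inv, div_eq_mul_inv]

instance {C : Type u} [Ctx M C] (n : C → M.El nat) [Rep n] : Rep (fun c => twoPowPred M (n c)) := by
  unfold twoPowPred; infer_instance

theorem le_twoPowPred (n : M.El nat) : n ≤ twoPowPred M n :=
  nat_induction (fun n : M.El nat => n ≤ twoPowPred M n) zero_le (fun n hn => by
    rw [← succ_eq n, twoPowPred_succ hM.out.toIsRCA₀ω, succ_eq, succ_eq]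
    gcongr
    exact hn.trans le_self_add) n

theorem wt_add_le (n i : M.El nat) : wt (n + i) ≤ wt n := by
  rw [wt_eq, wt_eq]
  have key : twoPowPred M n ≤ twoPowPred M (n + i) :=
    nat_induction (fun i : M.El nat => twoPowPred M n ≤ twoPowPred M (n + i)) (by simp)
      (fun i hi => by
        rw [← add_assoc, ← succ_eq (n + i), twoPowPred_succ hM.out.toIsRCA₀ω, succ_eq, add_assoc]
        exact hi.trans le_self_add) i
  have := den_pos (invTwoPow n)
  change 0 < toField (twoPowPred M n) + 1 at this
  gcongr
  exact toField_le.2 key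

theorem wt_anti {n m : M.El nat} (h : n ≤ m) : wt m ≤ wt n := by
  obtain ⟨i, rfl⟩ := (nat_le_iff _ _).1 h
  exact wt_add_le n i

/-- The field of rationals of `M` is Archimedean relative to the natural numbers of `M`. -/
theorem exists_nat_gt (z : RatField M) : ∃ n : M.El nat, z < toField n := by
  obtain ⟨p, rfl⟩ := exists_val z
  refine ⟨p.pos + 1, ?_⟩
  rw [val, div_lt_iff₀ (den_pos p), map_add, map_one]
  nlinarith [toField_nonneg p.pos, toField_nonneg p.neg, toField_nonneg p.den,
    mul_nonneg (toField_nonneg p.pos) (toField_nonneg p.den)]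

theorem exists_wt_lt {z : RatField M} (hz : 0 < z) : ∃ n : M.El nat, wt n < z := by
  obtain ⟨n, hn⟩ := exists_nat_gt z⁻¹
  refine ⟨n, ?_⟩
  rw [wt_eq]
  refine inv_lt_of_inv_lt₀ hz (hn.trans_le ?_)
  exact (toField_le.2 (le_twoPowPred n)).trans (le_add_of_nonneg_right zero_le_one)

theorem exists_wt_lt_ge {z : RatField M} (hz : 0 < z) (m : M.El nat) : ∃ n, m ≤ n ∧ wt n < z := by
  obtain ⟨n, hn⟩ := exists_wt_lt hz
  exact ⟨m + n, le_self_add, (wt_anti le_add_self).trans_lt hn⟩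

/-! ### Real numbers as cuts -/

open Classical in
/-- The `n`-th rational approximation of the real number `x`; it is `0` if `x ⬝ n` does not code a
fraction. -/
noncomputable def approx (x : M.El one) (n : M.El nat) : RatField M :=
  if h : ∃ p : Frac M, x ⬝ n = p.code then val h.choose else 0

theorem approx_eq {x : M.El one} {n : M.El nat} {p : Frac M} (h : x ⬝ n = p.code) :
    approx x n = val p := by
  have h' : ∃ p : Frac M, x ⬝ n = p.code := ⟨p, h⟩
  rw [approx, dif_pos h', code_injective (h'.choose_spec.symm.trans h)]

theorem isReal_iff (x : M.El one) : IsReal x ↔ (∀ n, ∃ p : Frac M, x ⬝ n = p.code) ∧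
    ∀ n m, n ≤ m → |approx x n - approx x m| < wt n := by
  refine and_congr_right fun h => ⟨fun h' n m hnm => ?_, fun h' n i p q hp hq => ?_⟩
  · obtain ⟨i, rfl⟩ := (nat_le_iff _ _).1 hnm
    obtain ⟨p, hp⟩ := h n
    obtain ⟨q, hq⟩ := h (n + i)
    rw [approx_eq hp, approx_eq hq, ← val_sub]
    exact (absLT_iff _ _).1 (h' n i p q hp hq)
  · have := h' n (n + i) le_self_add
    rw [approx_eq hp, approx_eq hq, ← val_sub] at this
    exact (absLT_iff _ _).2 this

/-- The set of the rationals of `M` below the real number `x`. -/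
noncomputable def cut (x : M.El one) : LowerSet (RatField M) where
  carrier := {c | ∃ n, c + 2 * wt n < approx x n}
  lower' := fun a b hab ⟨n, hn⟩ => ⟨n, by linarith⟩

/-- The cut of a rational number. -/
noncomputable abbrev ratCut (c : RatField M) : LowerSet (RatField M) := LowerSet.Iio c

theorem exists_mem_of_lt {S T : LowerSet (RatField M)} (h : S < T) : ∃ c ∈ T, c ∉ S :=
  Set.exists_of_ssubset (LowerSet.coe_ssubset_coe.2 h)

theorem ratCut_lt_iff {c : RatField M} {S : LowerSet (RatField M)} : ratCut c < S ↔ c ∈ S := by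
  constructor
  · intro h
    obtain ⟨d, hd, hd'⟩ := exists_mem_of_lt h
    exact S.lower (not_lt.1 hd') hd
  · intro h
    refine lt_of_le_of_ne (fun d hd => S.lower (le_of_lt hd) h) ?_
    rintro rfl
    exact lt_irrefl c h

theorem lt_ratCut_iff {c : RatField M} {S : LowerSet (RatField M)} :
    S < ratCut c ↔ ∃ d < c, d ∉ S := by
  constructor
  · intro h
    obtain ⟨d, hd, hd'⟩ := exists_mem_of_lt h
    exact ⟨d, hd, hd'⟩
  · rintro ⟨d, hd, hd'⟩
    by_contra h
    exact hd' ((not_lt.1 h) hd)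

theorem ratCut_lt_ratCut {c d : RatField M} : ratCut c < ratCut d ↔ c < d := ratCut_lt_iff

theorem ratCut_le_ratCut {c d : RatField M} : ratCut c ≤ ratCut d ↔ c ≤ d := by
  rw [← not_lt, ratCut_lt_ratCut, not_lt]

section

variable {x y : M.El one}

theorem IsReal.exists_code (hx : IsReal x) (n : M.El nat) :
    ∃ p : Frac M, x ⬝ n = p.code ∧ approx x n = val p := by
  obtain ⟨p, hp⟩ := hx.1 n
  exact ⟨p, hp, approx_eq hp⟩

theorem IsReal.lt_approx_add (hx : IsReal x) {c : RatField M} (hc : c ∈ cut x) (n : M.El nat) :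
    c < approx x n + wt n := by
  obtain ⟨m, hm⟩ := hc
  have h2 := ((isReal_iff x).1 hx).2
  have := wt_pos m
  rcases le_total n m with h | h
  · have := abs_lt.1 (h2 n m h); linarith
  · have := abs_lt.1 (h2 m n h); have := wt_pos n; linarith

theorem IsReal.mem_cut (hx : IsReal x) {c : RatField M} {n : M.El nat}
    (hc : c < approx x n - wt n) : c ∈ cut x := by
  obtain ⟨m, hm, hm'⟩ := exists_wt_lt_ge (z := (approx x n - wt n - c) / 2) (by linarith) n
  have := abs_lt.1 (((isReal_iff x).1 hx).2 n m hm)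
  exact ⟨m, by linarith⟩

theorem rlt_iff_approx (hx : IsReal x) (hy : IsReal y) :
    RLT x y ↔ ∃ n, approx x n + 2 * wt n < approx y n := by
  constructor
  · rintro ⟨n, p, q, hp, hq, h⟩
    refine ⟨n, ?_⟩
    rw [lt_iff, val_add, val_add] at h
    rw [approx_eq hp, approx_eq hq, wt]
    linarith
  · rintro ⟨n, h⟩
    obtain ⟨p, hp, hp'⟩ := hx.exists_code n
    obtain ⟨q, hq, hq'⟩ := hy.exists_code n
    refine ⟨n, p, q, hp, hq, ?_⟩
    rw [lt_iff, val_add, val_add, ← hp', ← hq', ← wt]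
    linarith

theorem rlt_iff (hx : IsReal x) (hy : IsReal y) : RLT x y ↔ cut x < cut y := by
  rw [rlt_iff_approx hx hy]
  constructor
  · rintro ⟨n, h⟩
    by_contra hlt
    have h1 : (approx x n + approx y n) / 2 ∈ cut y := hy.mem_cut (n := n) (by linarith)
    have := hx.lt_approx_add (not_lt.1 hlt h1) n
    linarith
  · intro h
    obtain ⟨c, hc, hc'⟩ := exists_mem_of_lt h
    obtain ⟨n, hn⟩ := hc
    have w0 := wt_pos n
    obtain ⟨m, hm, hm'⟩ := exists_wt_lt_ge (z := wt n / 4) (by linarith) n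
    refine ⟨m, ?_⟩
    have h1 := abs_lt.1 (((isReal_iff y).1 hy).2 n m hm)
    have h2 : approx x m - wt m ≤ c := le_of_not_gt fun h => hc' (hx.mem_cut h)
    linarith

theorem rle_iff (hx : IsReal x) (hy : IsReal y) : RLE x y ↔ cut x ≤ cut y := by
  rw [RLE, rlt_iff hy hx, not_lt]

theorem req_iff (hx : IsReal x) (hy : IsReal y) : REq x y ↔ cut x = cut y := by
  rw [REq, rle_iff hx hy, rle_iff hy hx, le_antisymm_iff]

theorem IsReal.exists_bounds (hx : IsReal x) {z : RatField M} (hz : 0 < z) :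
    ∃ c d, ratCut c < cut x ∧ cut x < ratCut d ∧ d - c < z := by
  obtain ⟨n, hn⟩ := exists_wt_lt (z := z / 6) (by linarith)
  have := wt_pos n
  refine ⟨approx x n - 2 * wt n, approx x n + 2 * wt n, ratCut_lt_iff.2 (hx.mem_cut (n := n) ?_),
    lt_ratCut_iff.2 ⟨approx x n + wt n, ?_, fun h => ?_⟩, ?_⟩
  · linarith
  · linarith
  · exact (hx.lt_approx_add h n).false
  · linarith

/-- The rationals are dense. -/
theorem exists_ratCut_between {S : LowerSet (RatField M)} (h : S < cut y) :
    ∃ c, S < ratCut c ∧ ratCut c < cut y := by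
  obtain ⟨c, ⟨n, hn⟩, hc'⟩ := exists_mem_of_lt h
  refine ⟨(c + approx y n - 2 * wt n) / 2, lt_ratCut_iff.2 ⟨c, by linarith, hc'⟩,
    ratCut_lt_iff.2 ⟨n, by linarith⟩⟩

theorem near_iff_approx (hx : IsReal x) (hy : IsReal y) (k : M.El nat) :
    Near k x y ↔ ∃ n, |approx x n - approx y n| + 2 * wt n < wt k := by
  constructor
  · rintro ⟨n, p, q, hp, hq, h, h'⟩
    refine ⟨n, ?_⟩
    rw [lt_iff, val_add, val_add, val_sub, ← wt, ← wt] at h h'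
    rw [approx_eq hp, approx_eq hq, ← lt_sub_iff_add_lt, abs_lt]
    constructor <;> linarith
  · rintro ⟨n, h⟩
    obtain ⟨p, hp, hp'⟩ := hx.exists_code n
    obtain ⟨q, hq, hq'⟩ := hy.exists_code n
    rw [← lt_sub_iff_add_lt, abs_lt] at h
    refine ⟨n, p, q, hp, hq, ?_, ?_⟩ <;>
    · rw [lt_iff, val_add, val_add, val_sub, ← hp', ← hq', ← wt, ← wt]
      linarith

theorem near_iff (hx : IsReal x) (hy : IsReal y) (k : M.El nat) :
    Near k x y ↔ ∃ c d, d - c < wt k ∧ (ratCut c < cut x ∧ cut x < ratCut d) ∧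
      (ratCut c < cut y ∧ cut y < ratCut d) := by
  rw [near_iff_approx hx hy]
  constructor
  · rintro ⟨n, h⟩
    obtain ⟨e, he, he'⟩ : ∃ e, 0 < e ∧ |approx x n - approx y n| + 2 * wt n + 3 * e < wt k :=
      ⟨(wt k - |approx x n - approx y n| - 2 * wt n) / 4, by linarith, by linarith⟩
    have h1 := le_abs_self (approx x n - approx y n)
    have h2 := neg_abs_le (approx x n - approx y n)
    have h3 : max (approx x n) (approx y n) - min (approx x n) (approx y n) =
      |approx x n - approx y n| := max_sub_min_eq_abs' _ _
    have h4 := min_le_left (approx x n) (approx y n)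
    have h5 := min_le_right (approx x n) (approx y n)
    have h6 := le_max_left (approx x n) (approx y n)
    have h7 := le_max_right (approx x n) (approx y n)
    refine ⟨min (approx x n) (approx y n) - wt n - e, max (approx x n) (approx y n) + wt n + e,
      by linarith, ⟨ratCut_lt_iff.2 (hx.mem_cut (n := n) (by linarith)),
        lt_ratCut_iff.2 ⟨max (approx x n) (approx y n) + wt n, by linarith, fun h => ?_⟩⟩,
      ratCut_lt_iff.2 (hy.mem_cut (n := n) (by linarith)),
        lt_ratCut_iff.2 ⟨max (approx x n) (approx y n) + wt n, by linarith, fun h => ?_⟩⟩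
    · have := hx.lt_approx_add h n; linarith
    · have := hy.lt_approx_add h n; linarith
  · rintro ⟨c, d, hcd, ⟨h1, h2⟩, h3, h4⟩
    obtain ⟨n, hn⟩ := exists_wt_lt (z := (wt k - (d - c)) / 4) (by linarith)
    refine ⟨n, ?_⟩
    have upper : ∀ {x : M.El one}, IsReal x → cut x < ratCut d → approx x n - wt n ≤ d :=
      fun {x} hx h => by
        obtain ⟨e, he, he'⟩ := lt_ratCut_iff.1 h
        exact le_of_not_gt fun h => he' (hx.mem_cut (n := n) (by linarith))
    have a1 := hx.lt_approx_add (ratCut_lt_iff.1 h1) n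
    have a2 := upper hx h2
    have a3 := hy.lt_approx_add (ratCut_lt_iff.1 h3) n
    have a4 := upper hy h4
    rw [← lt_sub_iff_add_lt, abs_lt]
    constructor <;> linarith

end

theorem approx_toReal (p : Frac M) (n : M.El nat) : approx p.toReal n = val p :=
  approx_eq (hM.out.combK_eq _ _)

theorem isReal_toReal (p : Frac M) : IsReal p.toReal := by
  refine (isReal_iff _).2 ⟨fun n => ⟨p, hM.out.combK_eq _ _⟩, fun n m _ => ?_⟩
  rw [approx_toReal, approx_toReal, sub_self, abs_zero]
  exact wt_pos n

theorem cut_toReal (p : Frac M) : cut p.toReal = ratCut (val p) := by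
  ext c
  change (∃ n, c + 2 * wt n < approx p.toReal n) ↔ c < val p
  simp only [approx_toReal]
  constructor
  · rintro ⟨n, hn⟩
    linarith [wt_pos n]
  · intro h
    obtain ⟨n, hn⟩ := exists_wt_lt (z := (val p - c) / 2) (by linarith)
    exact ⟨n, by linarith⟩

end Rationals

/-! ### Definability of notions about rational and real numbers -/

section RealDefinability

open Frac

variable {M : TypeStructure.{u}} [hM : Fact M.IsACA₀ω] {C : Type u} [Ctx M C] {ρ σ τ : FType}

/-- The family of fractions `p` on the context `C` exists in `M`. -/
class RepFrac (p : C → Frac M) : Prop where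
  pos : Rep (fun c => (p c).pos)
  neg : Rep (fun c => (p c).neg)
  den : Rep (fun c => (p c).den)

attribute [instance] RepFrac.pos RepFrac.neg RepFrac.den

instance (priority := 2000) RepFrac.const (p : Frac M) : RepFrac (fun _ : C => p) :=
  ⟨inferInstance, inferInstance, inferInstance⟩

instance (priority := 1900) RepFrac.of_mk (a b d : C → M.El nat) [Rep a] [Rep b] [Rep d] :
    RepFrac (fun c => (⟨a c, b c, d c⟩ : Frac M)) :=
  ⟨by assumption, by assumption, by assumption⟩

instance RepFrac.add (p q : C → Frac M) [RepFrac p] [RepFrac q] : RepFrac (fun c => p c + q c) where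
  pos := inferInstanceAs (Rep (fun c =>
    (p c).pos * ((q c).den + 1) + (q c).pos * ((p c).den + 1)))
  neg := inferInstanceAs (Rep (fun c =>
    (p c).neg * ((q c).den + 1) + (q c).neg * ((p c).den + 1)))
  den := inferInstanceAs (Rep (fun c => (p c).den * (q c).den + (p c).den + (q c).den))

instance RepFrac.neg' (p : C → Frac M) [h : RepFrac p] : RepFrac (fun c => -p c) where
  pos := h.neg
  neg := h.pos
  den := h.den

instance RepFrac.sub (p q : C → Frac M) [RepFrac p] [RepFrac q] : RepFrac (fun c => p c - q c) :=
  inferInstanceAs (RepFrac (fun c => p c + -q c))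

instance RepFrac.invTwoPow (n : C → M.El nat) [Rep n] : RepFrac (fun c => invTwoPow (n c)) where
  pos := inferInstanceAs (Rep (fun _ => 1))
  neg := inferInstanceAs (Rep (fun _ => 0))
  den := inferInstanceAs (Rep (fun c => twoPowPred M (n c)))

instance Rep.pair (a b : C → M.El nat) [Rep a] [Rep b] : Rep (fun c => pair (a c) (b c)) :=
  inferInstanceAs (Rep (fun c => (a c + b c) * (a c + b c) + a c))

instance Rep.code (p : C → Frac M) [RepFrac p] : Rep (fun c => (p c).code) :=
  inferInstanceAs (Rep (fun c => Frac.pair (Frac.pair (p c).pos (p c).neg) (p c).den))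

instance Rep.toReal (p : C → Frac M) [RepFrac p] : Rep (fun c => (p c).toReal) :=
  inferInstanceAs (Rep (fun c => M.combK nat nat ⬝ (p c).code))

instance Dec.fracLT (p q : C → Frac M) [RepFrac p] [RepFrac q] : Dec M (fun c => p c < q c) :=
  inferInstanceAs (Dec M (fun c => (p c).pos * ((q c).den + 1) + (q c).neg * ((p c).den + 1) <
    (q c).pos * ((p c).den + 1) + (p c).neg * ((q c).den + 1)))

instance Dec.absLT (p q : C → Frac M) [RepFrac p] [RepFrac q] :
    Dec M (fun c => AbsLT (p c) (q c)) :=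
  inferInstanceAs (Dec M (fun c => p c < q c ∧ -p c < q c))

instance Dec.exFrac (P : C → Frac M → Prop)
    [Dec M (fun c : ((C × M.El nat) × M.El nat) × M.El nat => P c.1.1.1 ⟨c.1.1.2, c.1.2, c.2⟩)] :
    Dec M (fun c => ∃ p, P c p) :=
  Dec.congr (P := fun c => ∃ a b d, P c ⟨a, b, d⟩) inferInstance
    fun _ => ⟨fun ⟨_, _, _, h⟩ => ⟨_, h⟩, fun ⟨p, h⟩ => ⟨p.pos, p.neg, p.den, h⟩⟩

instance Dec.allFrac (P : C → Frac M → Prop)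
    [Dec M (fun c : ((C × M.El nat) × M.El nat) × M.El nat => P c.1.1.1 ⟨c.1.1.2, c.1.2, c.2⟩)] :
    Dec M (fun c => ∀ p, P c p) :=
  Dec.congr (P := fun c => ∀ a b d, P c ⟨a, b, d⟩) inferInstance
    fun _ => ⟨fun h p => h p.pos p.neg p.den, fun h _ _ _ => h _⟩

theorem exists_decider₃ (P : M.El ρ → M.El σ → M.El τ → Prop)
    [h : Dec M (fun c : ((PUnit.{u + 1} × M.El ρ) × M.El σ) × M.El τ => P c.1.1.2 c.1.2 c.2)] :
    ∃ F : M.El (ρ ⇒ σ ⇒ τ ⇒ nat), ∀ x y z, F ⬝ x ⬝ y ⬝ z = 0 ↔ P x y z := by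
  obtain ⟨φ, _, hφ⟩ := h.out
  obtain ⟨F, hF⟩ := exists_fun₃ (fun x y z => φ (((PUnit.unit, x), y), z)) (h := by assumption)
  exact ⟨F, fun x y z => by rw [hF, hφ]⟩

instance Dec.rlt (x y : C → M.El one) [Rep x] [Rep y] : Dec M (fun c => RLT (x c) (y c)) := by
  obtain ⟨F, hF⟩ := exists_decider₂ (M := M) (fun x y : M.El one =>
    ∃ (n : M.El nat) (p q : Frac M), x ⬝ n = p.code ∧ y ⬝ n = q.code ∧
      p + (Frac.invTwoPow n + Frac.invTwoPow n) < q)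
  exact Dec.congr (P := fun c => F ⬝ x c ⬝ y c = 0) inferInstance fun c => hF _ _

set_option synthInstance.maxHeartbeats 400000 in
set_option synthInstance.maxSize 1000 in
instance Dec.near (k : C → M.El nat) (x y : C → M.El one) [Rep k] [Rep x] [Rep y] :
    Dec M (fun c => Near (k c) (x c) (y c)) := by
  obtain ⟨F, hF⟩ := exists_decider₃ (M := M) (fun (k : M.El nat) (x y : M.El one) =>
    ∃ (n : M.El nat) (p q : Frac M), x ⬝ n = p.code ∧ y ⬝ n = q.code ∧
      (p - q) + (Frac.invTwoPow n + Frac.invTwoPow n) < Frac.invTwoPow k ∧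
      (q - p) + (Frac.invTwoPow n + Frac.invTwoPow n) < Frac.invTwoPow k)
  exact Dec.congr (P := fun c => F ⬝ k c ⬝ x c ⬝ y c = 0) inferInstance fun c => hF _ _ _

instance Dec.rle (x y : C → M.El one) [Rep x] [Rep y] : Dec M (fun c => RLE (x c) (y c)) :=
  inferInstanceAs (Dec M (fun c => ¬ RLT (y c) (x c)))

instance Dec.req (x y : C → M.El one) [Rep x] [Rep y] : Dec M (fun c => REq (x c) (y c)) :=
  inferInstanceAs (Dec M (fun c => RLE (x c) (y c) ∧ RLE (y c) (x c)))

instance Dec.isReal (x : C → M.El one) [Rep x] : Dec M (fun c => IsReal (x c)) := by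
  obtain ⟨F, hF⟩ := exists_decider (M := M) (fun x : M.El one =>
    (∀ n, ∃ p : Frac M, x ⬝ n = p.code) ∧
      ∀ (n i : M.El nat) (p q : Frac M), x ⬝ n = p.code → x ⬝ (n + i) = q.code →
        AbsLT (p - q) (Frac.invTwoPow n))
  exact Dec.congr (P := fun c => F ⬝ x c = 0) inferInstance fun c => hF _

/-! ### Least numbers and choice -/

/-- Definition by cases. -/
instance Rep.ite (P : C → Prop) [∀ c, Decidable (P c)] (a b : C → M.El nat) [h : Dec M P]
    [Rep a] [Rep b] :
    Rep (fun c => if P c then a c else b c) := by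
  obtain ⟨φ, _, hφ⟩ := h.out
  have : (fun c => if P c then a c else b c) = fun c => M.recR ⬝ φ c ⬝ a c ⬝
      (M.combK (nat ⇒ nat) nat ⬝ (M.combK nat nat ⬝ b c)) := by
    funext c
    by_cases hc : P c
    · rw [if_pos hc, (hφ c).2 hc, hM.out.recR_zero]
    · obtain h0 | ⟨n, hn⟩ := nat_cases (φ c)
      · exact absurd ((hφ c).1 h0) hc
      · rw [if_neg hc, hn, ← succ_eq, hM.out.recR_succ, hM.out.combK_eq, hM.out.combK_eq]
  rw [this]
  infer_instance

theorem exists_least (P : M.El nat → Prop) [Dec M (fun c : PUnit.{u + 1} × M.El nat => P c.2)]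
    (h : ∃ n, P n) : ∃ n, P n ∧ ∀ m < n, ¬ P m := by
  obtain ⟨F, hF⟩ := exists_decider P
  simp only [← hF] at h ⊢
  by_contra hne
  push Not at hne
  have key : ∀ n : M.El nat, ∀ m, m < n → ¬ F ⬝ m = 0 := fun n =>
    nat_induction (fun n : M.El nat => ∀ m, m < n → ¬ F ⬝ m = 0) (fun m hm => absurd hm not_lt_zero)
      (fun n hn m hm hPm => by
        rcases ((nat_lt_add_one m n).1 hm).lt_or_eq with h | rfl
        · exact hn m h hPm
        · obtain ⟨l, hl, hPl⟩ := hne m hPm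
          exact hn l hl hPl) n
  obtain ⟨n, hn⟩ := h
  exact key (n + 1) n ((nat_lt_add_one n n).2 le_rfl) hn

/-- The assignment of `G` to the variables of type `1 → 0 → 0`. -/
def paramAssignment (G : M.El (one ⇒ nat ⇒ nat)) : Assignment M
  | .arr (.arr .nat .nat) (.arr .nat .nat), _ => G
  | σ, _ => dflt M σ

/-- The axiom `QF-AC^{1,0}` for arithmetical predicates. -/
theorem exists_choice (P : M.El one → M.El nat → Prop)
    [Dec M (fun c : (PUnit.{u + 1} × M.El one) × M.El nat => P c.1.2 c.2)] (h : ∀ f, ∃ n, P f n) :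
    ∃ F : M.El two, ∀ f, P f (F ⬝ f) := by
  obtain ⟨G, hG⟩ := exists_decider₂ P
  obtain ⟨F, hF⟩ := hM.out.qfChoice
    (.eq (.app (.app (.var (one ⇒ nat ⇒ nat) 0) (.var one 0)) (.var nat 0)) .zero)
    (paramAssignment G)
    (fun f => by
      obtain ⟨n, hn⟩ := h f
      exact ⟨n, (hG f n).2 hn⟩)
  exact ⟨F, fun f => (hG f _).1 (hF f)⟩

open Classical in
/-- The least number with the property `P`, and `0` if there is none. -/
noncomputable def least (P : M.El nat → Prop) : M.El nat :=
  if h : ∃ n, P n ∧ ∀ m < n, ¬ P m then h.choose else 0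

theorem least_eq {P : M.El nat → Prop} {n : M.El nat} (h : P n) (h' : ∀ m < n, ¬ P m) :
    least P = n := by
  have h₀ : ∃ n, P n ∧ ∀ m < n, ¬ P m := ⟨n, h, h'⟩
  rw [least, dif_pos h₀]
  obtain ⟨h₁, h₂⟩ := h₀.choose_spec
  exact le_antisymm (not_lt.1 fun hlt => h₂ _ hlt h) (not_lt.1 fun hlt => h' _ hlt h₁)

theorem least_spec (P : M.El nat → Prop) [Dec M (fun c : PUnit.{u + 1} × M.El nat => P c.2)]
    (h : ∃ n, P n) : P (least P) := by
  obtain ⟨n, hn, hn'⟩ := exists_least P h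
  rwa [least_eq hn hn']

/-- Feferman's search operator. -/
theorem exists_search : ∃ μ : M.El two, ∀ f, μ ⬝ f = least (fun n => f ⬝ n = 0) := by
  obtain ⟨μ, hμ⟩ := exists_choice (M := M) (fun f n =>
    (f ⬝ n = 0 ∧ ∀ m, m < n → ¬ f ⬝ m = 0) ∨ ((∀ m, ¬ f ⬝ m = 0) ∧ n = 0)) (fun f => by
      by_cases h : ∃ n, f ⬝ n = 0
      · obtain ⟨n, hn, hn'⟩ := exists_least (fun n => f ⬝ n = 0) h
        exact ⟨n, .inl ⟨hn, hn'⟩⟩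
      · exact ⟨0, .inr ⟨not_exists.1 h, rfl⟩⟩)
  refine ⟨μ, fun f => ?_⟩
  rcases hμ f with ⟨h, h'⟩ | ⟨h, h'⟩
  · exact (least_eq (P := fun n => f ⬝ n = 0) h h').symm
  · rw [h', least, dif_neg]
    rintro ⟨n, hn, -⟩
    exact h n hn

instance Rep.least (P : C → M.El nat → Prop) [h : Dec M (fun c : C × M.El nat => P c.1 c.2)] :
    Rep (fun c => least (P c)) := by
  obtain ⟨φ, _, hφ⟩ := h.out
  obtain ⟨ψ, _, hψ⟩ := Rep.curry φ
  obtain ⟨μ, hμ⟩ := exists_search (M := M)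
  have : (fun c => HigherOrder.least (P c)) = fun c => μ ⬝ ψ c := by
    funext c
    simp only [hμ, hψ, hφ]
  rw [this]
  infer_instance

/-- Choice for sequences of numbers, by taking the least witnesses. -/
theorem exists_seq (P : M.El nat → M.El nat → Prop)
    [Dec M (fun c : (PUnit.{u + 1} × M.El nat) × M.El nat => P c.1.2 c.2)]
    (h : ∀ n, ∃ m, P n m) : ∃ y : M.El one, ∀ n, P n (y ⬝ n) := by
  obtain ⟨G, hG⟩ := exists_decider₂ P
  obtain ⟨y, hy⟩ := exists_fun (M := M) (fun n => least (fun m => G ⬝ n ⬝ m = 0))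
  refine ⟨y, fun n => ?_⟩
  rw [hy, ← hG]
  exact least_spec (fun m => G ⬝ n ⬝ m = 0) (by simpa only [hG] using h n)

theorem exists_seq₂ (P : M.El nat → M.El nat → M.El nat → Prop)
    [Dec M (fun c : ((PUnit.{u + 1} × M.El nat) × M.El nat) × M.El nat => P c.1.1.2 c.1.2 c.2)]
    (h : ∀ k n, ∃ m, P k n m) : ∃ y : M.El (nat ⇒ one), ∀ k n, P k n (y ⬝ k ⬝ n) := by
  obtain ⟨G, hG⟩ := exists_decider₃ P
  obtain ⟨y, hy⟩ := exists_fun₂ (M := M) (fun k n => least (fun m => G ⬝ k ⬝ n ⬝ m = 0))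
  refine ⟨y, fun k n => ?_⟩
  rw [hy, ← hG]
  exact least_spec (fun m => G ⬝ k ⬝ n ⬝ m = 0) (by simpa only [hG] using h k n)

/-! ### Rational translations of real numbers -/

/-- `y` is the translate of the real number `x` by the rational number `r`. -/
structure IsTranslate (x y : M.El one) (r : RatField M) : Prop where
  isReal_right : IsReal y
  approx_eq : ∀ n, approx y n = approx x n + r

namespace IsTranslate

variable {x y : M.El one} {r : RatField M}

theorem mem_cut (h : IsTranslate x y r) (c : RatField M) : c ∈ cut y ↔ c - r ∈ cut x := by
  change (∃ n, c + 2 * wt n < approx y n) ↔ ∃ n, c - r + 2 * wt n < approx x n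
  refine exists_congr fun n => ?_
  rw [h.approx_eq]
  constructor <;> intro h <;> linarith

theorem lt_cut (h : IsTranslate x y r) (c : RatField M) :
    ratCut c < cut y ↔ ratCut (c - r) < cut x := by
  rw [ratCut_lt_iff, ratCut_lt_iff, h.mem_cut]

theorem cut_lt (h : IsTranslate x y r) (c : RatField M) :
    cut y < ratCut c ↔ cut x < ratCut (c - r) := by
  rw [lt_ratCut_iff, lt_ratCut_iff]
  constructor
  · rintro ⟨d, hd, hd'⟩
    exact ⟨d - r, by linarith, by rwa [← h.mem_cut]⟩
  · rintro ⟨d, hd, hd'⟩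
    exact ⟨d + r, by linarith, by rwa [h.mem_cut, add_sub_cancel_right]⟩

theorem cut_eq (h : IsTranslate x y r) (c : RatField M) :
    cut y = ratCut c ↔ cut x = ratCut (c - r) := by
  constructor <;> intro h'
  · exact le_antisymm (not_lt.1 fun hlt => ((h.lt_cut c).2 hlt).ne' h')
      (not_lt.1 fun hlt => ((h.cut_lt c).2 hlt).ne h')
  · exact le_antisymm (not_lt.1 fun hlt => ((h.lt_cut c).1 hlt).ne' h')
      (not_lt.1 fun hlt => ((h.cut_lt c).1 hlt).ne h')

end IsTranslate

/-- A definable sequence of translates of `x`, by rationals chosen according to `P`, whose second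
argument is the code of a rational. -/
theorem exists_translates {x : M.El one} (hx : IsReal x) (P : M.El nat → M.El nat → Prop)
    [Dec M (fun c : (PUnit.{u + 1} × M.El nat) × M.El nat => P c.1.2 c.2)]
    (h : ∀ k, ∃ r : Frac M, P k r.code) :
    ∃ s : M.El (nat ⇒ one), ∀ k, ∃ r : Frac M, P k r.code ∧ IsTranslate x (s ⬝ k) (val r) := by
  -- `g` is the sequence of the codes of the rationals, `s` adds them to the entries of `x`
  obtain ⟨G, hG⟩ := exists_decider₂ P
  obtain ⟨g, hg⟩ := exists_seq (M := M) (fun k m => ∃ r : Frac M, m = r.code ∧ G ⬝ k ⬝ m = 0)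
    (fun k => by
      obtain ⟨r, hr⟩ := h k
      exact ⟨r.code, r, rfl, (hG _ _).2 hr⟩)
  obtain ⟨s, hs⟩ := exists_seq₂ (M := M) (fun k n m => ∃ p r : Frac M, x ⬝ n = p.code ∧
    g ⬝ k = r.code ∧ m = (p + r).code) (fun k n => by
      obtain ⟨p, hp⟩ := hx.1 n
      obtain ⟨r, hr, -⟩ := hg k
      exact ⟨_, p, r, hp, hr, rfl⟩)
  refine ⟨s, fun k => ?_⟩
  obtain ⟨r, hr, hP⟩ := hg k
  rw [hr] at hP
  have key : ∀ n, approx (s ⬝ k) n = approx x n + val r := fun n => by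
    obtain ⟨p, r', hp, hr', hm⟩ := hs k n
    rw [code_injective (hr.symm.trans hr'), approx_eq hm, approx_eq hp, val_add]
  refine ⟨r, (hG _ _).1 hP, (isReal_iff _).2 ⟨fun n => ?_, fun n m hnm => ?_⟩, key⟩
  · obtain ⟨p, r', -, -, hm⟩ := hs k n
    exact ⟨_, hm⟩
  · rw [key, key, add_sub_add_right_eq_sub]
    exact ((isReal_iff x).1 hx).2 n m hnm

theorem exists_translate {x : M.El one} (hx : IsReal x) (r : RatField M) :
    ∃ y, IsTranslate x y r := by
  obtain ⟨p, rfl⟩ := exists_val r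
  obtain ⟨s, hs⟩ := exists_translates hx (fun _ m => m = p.code) (fun k => ⟨p, rfl⟩)
  obtain ⟨q, hq, h⟩ := hs 0
  rw [code_injective hq] at h
  exact ⟨_, h⟩

end RealDefinability

/-! ### Suprema from `BOOT` -/

section Suprema

open Frac

variable {M : TypeStructure.{u}} [hM : Fact M.IsACA₀ω]

/-- The properties of the domains `ℝ` and `[0, 1]` that matter: they are arithmetically definable
intervals that contain `[0, 1]`. -/
structure IsDomainSet (D : Set (M.El one)) : Prop where
  isReal : ∀ x ∈ D, IsReal x
  convex : ∀ x ∈ D, ∀ z ∈ D, ∀ y, IsReal y → cut x ≤ cut y → cut y ≤ cut z → y ∈ D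
  zero_mem : toReal 0 ∈ D
  one_mem : toReal 1 ∈ D
  decider : ∃ d : M.El two, ∀ x, d ⬝ x = 0 ↔ x ∈ D

theorem isDomainSet_line : IsDomainSet (Line M) where
  isReal _ h := h
  convex _ _ _ _ _ hy _ _ := hy
  zero_mem := isReal_toReal 0
  one_mem := isReal_toReal 1
  decider := exists_decider (fun x : M.El one => IsReal x)

theorem mem_unitInterval_iff (x : M.El one) :
    x ∈ UnitInterval M ↔ IsReal x ∧ ratCut 0 ≤ cut x ∧ cut x ≤ ratCut 1 := by
  refine and_congr_right fun hx => ?_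
  rw [rle_iff (isReal_toReal 0) hx, rle_iff hx (isReal_toReal 1), cut_toReal, cut_toReal, val_zero,
    val_one]

theorem isDomainSet_unitInterval : IsDomainSet (UnitInterval M) where
  isReal _ h := h.1
  convex x hx z hz y hy h h' := by
    rw [mem_unitInterval_iff] at *
    exact ⟨hy, hx.2.1.trans h, h'.trans hz.2.2⟩
  zero_mem := by
    rw [mem_unitInterval_iff, cut_toReal, val_zero]
    exact ⟨isReal_toReal 0, le_rfl, ratCut_le_ratCut.2 zero_le_one⟩
  one_mem := by
    rw [mem_unitInterval_iff, cut_toReal, val_one]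
    exact ⟨isReal_toReal 1, ratCut_le_ratCut.2 zero_le_one, le_rfl⟩
  decider := exists_decider (fun x : M.El one => IsReal x ∧ RLE (toReal 0) x ∧ RLE x (toReal 1))

/-- A definable proper initial segment of the rationals has a boundary that can be located with any
precision.  This is where arithmetical induction enters the proof of the supremum principle. -/
theorem exists_boundary (U : M.El nat → Prop) [Dec M (fun c : PUnit.{u + 1} × M.El nat => U c.2)]
    (hU : ∀ r r' : Frac M, val r' ≤ val r → U r.code → U r'.code) (h0 : ∃ r : Frac M, U r.code)
    (h1 : ∃ r : Frac M, ¬ U r.code) (n : M.El nat) :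
    ∃ r : Frac M, U r.code ∧ ¬ U (r + invTwoPow n).code := by
  obtain ⟨F, hF⟩ := exists_decider U
  by_contra! hne
  obtain ⟨r, hr⟩ := h0
  obtain ⟨r', hr'⟩ := h1
  have hval : ∀ k : M.El nat, val ⟨k, 0, twoPowPred M n⟩ = toField k * wt n := fun k => by
    rw [wt_eq, val, map_zero, sub_zero, div_eq_mul_inv]
  have key : ∀ k : M.El nat, F ⬝ (r + ⟨k, 0, twoPowPred M n⟩).code = 0 := fun k =>
    nat_induction (fun k : M.El nat => F ⬝ (r + ⟨k, 0, twoPowPred M n⟩).code = 0)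
      ((hF _).2 (hU r _ (by rw [val_add, hval, map_zero, zero_mul, add_zero]) hr))
      (fun k hk => (hF _).2 (hU _ _ (le_of_eq ?_) (hne _ ((hF _).1 hk)))) k
  · obtain ⟨k, hk⟩ := exists_nat_gt ((val r' - val r) / wt n)
    rw [div_lt_iff₀ (wt_pos n)] at hk
    refine hr' (hU _ _ ?_ ((hF _).1 (key k)))
    rw [val_add, hval]
    linarith
  · rw [val_add, val_add, val_add, hval, hval, ← wt, map_add, map_one]
    ring

section

variable {D : Set (M.El one)} {f : M.El (one ⇒ one)} {p q : Frac M}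

/-- `U` is the set of (codes of) rationals that are smaller than some value of `f` on `[p, q]`. -/
def IsBelowSet (D : Set (M.El one)) (f : M.El (one ⇒ one)) (p q : Frac M)
    (U : M.El nat → Prop) : Prop :=
  ∀ r : Frac M, U r.code ↔
    ∃ x ∈ D, RLE p.toReal x ∧ RLE x q.toReal ∧ ratCut (val r) < cut (f ⬝ x)

theorem IsBelowSet.exists_value {U : M.El nat → Prop} (hU : IsBelowSet D f p q U)
    (hf : IsFun D (Line M) f) {y : M.El one} {r : Frac M} (hr : U r.code) (hy : IsReal y)
    (hry : cut y ≤ ratCut (val r)) :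
    ∃ x ∈ D, RLE p.toReal x ∧ RLE x q.toReal ∧ ¬ RLE (f ⬝ x) y := by
  obtain ⟨x, hx, hpx, hxq, h⟩ := (hU r).1 hr
  exact ⟨x, hx, hpx, hxq, by rw [rle_iff (hf.1 x hx) hy, not_le]; exact hry.trans_lt h⟩

theorem IsBelowSet.exists_mem {U : M.El nat → Prop} (hU : IsBelowSet D f p q U)
    {x : M.El one} (hx : x ∈ D) (hpx : RLE p.toReal x)
    (hxq : RLE x q.toReal) {S : LowerSet (RatField M)} (h : S < cut (f ⬝ x)) :
    ∃ r : Frac M, U r.code ∧ S < ratCut (val r) := by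
  obtain ⟨c, hc, hc'⟩ := exists_ratCut_between h
  obtain ⟨r, rfl⟩ := exists_val c
  exact ⟨r, (hU r).2 ⟨x, hx, hpx, hxq, hc'⟩, hc⟩

theorem isSupremum_bot {U : M.El nat → Prop} (hU : IsBelowSet D f p q U) (hf : IsFun D (Line M) f)
    (h : ¬ ∃ r : Frac M, U r.code) (s : M.El one) : IsSupremum D f p q ⟨1 + 1, s⟩ := by
  refine ⟨.inr (.inr rfl), fun x hx hpx hxq => ?_, fun _ _ _ => .inl rfl⟩
  obtain ⟨c, d, hc, -⟩ := IsReal.exists_bounds (hf.1 x hx) (one_pos (α := RatField M))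
  obtain ⟨r, hr, -⟩ := hU.exists_mem hx hpx hxq hc
  exact absurd ⟨r, hr⟩ h

theorem isSupremum_top {U : M.El nat → Prop} (hU : IsBelowSet D f p q U) (hf : IsFun D (Line M) f)
    (h : ∀ r : Frac M, U r.code) (s : M.El one) : IsSupremum D f p q ⟨1, s⟩ := by
  refine ⟨.inr (.inl rfl), fun x hx hpx hxq => .inr (.inl rfl), fun e he hub => ?_⟩
  rcases he with ⟨he, he'⟩ | he | he
  · obtain ⟨c, d, -, hd, -⟩ := he'.exists_bounds (one_pos (α := RatField M))
    obtain ⟨r, rfl⟩ := exists_val d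
    obtain ⟨x, hx, hpx, hxq, hn⟩ := hU.exists_value hf (h r) he' hd.le
    rcases hub x hx hpx hxq with h | h | h
    · exact absurd (show (0 : M.El nat) = 1 + 1 from h) (by norm_num)
    · exact absurd (he.symm.trans h) (by norm_num)
    · exact absurd h.2.2 hn
  · exact .inr (.inl he)
  · obtain ⟨x, hx, hpx, hxq, -⟩ := hU.exists_value hf (h 0) (isReal_toReal 0) (cut_toReal 0).le
    rcases hub x hx hpx hxq with h | h | h
    · exact absurd (show (0 : M.El nat) = 1 + 1 from h) (by norm_num)
    · exact absurd (he.symm.trans h) (by norm_num)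
    · exact absurd (he.symm.trans h.2.1) (by norm_num)

theorem isSupremum_real {U : M.El nat → Prop} (hU : IsBelowSet D f p q U)
    (hf : IsFun D (Line M) f) {s : M.El one}
    (hs : ∀ n, ∃ r : Frac M, s ⬝ n = r.code ∧ U r.code ∧ ¬ U (r + invTwoPow n).code) :
    IsSupremum D f p q ⟨0, s⟩ := by
  have lower : ∀ r r' : Frac M, val r' ≤ val r → U r.code → U r'.code := fun r r' h hr => by
    rw [hU] at hr ⊢
    obtain ⟨x, hx, hpx, hxq, h'⟩ := hr
    exact ⟨x, hx, hpx, hxq, (ratCut_le_ratCut.2 h).trans_lt h'⟩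
  have close : ∀ (r : Frac M) n, U r.code → val r < approx s n + wt n := fun r n hr => by
    obtain ⟨r', h, -, h''⟩ := hs n
    rw [approx_eq h, wt, ← val_add]
    exact lt_of_not_ge fun hle => h'' (lower _ _ hle hr)
  have real : IsReal s := by
    refine (isReal_iff s).2 ⟨fun n => ?_, fun n m hnm => ?_⟩
    · obtain ⟨r, h, -⟩ := hs n
      exact ⟨r, h⟩
    · obtain ⟨r, h, h', -⟩ := hs n
      obtain ⟨l, k, k', -⟩ := hs m
      have h1 := close r m h'
      have h2 := close l n k'
      have := wt_anti hnm
      rw [approx_eq h, approx_eq k] at *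
      rw [abs_lt]
      constructor <;> linarith
  have mem : ∀ r : Frac M, ratCut (val r) < cut s → U r.code := fun r hr => by
    obtain ⟨n, hn⟩ := ratCut_lt_iff.1 hr
    obtain ⟨l, h, h', -⟩ := hs n
    rw [approx_eq h] at hn
    exact lower _ _ (by linarith [wt_pos n]) h'
  have le : ∀ r : Frac M, U r.code → ratCut (val r) ≤ cut s := fun r hr => by
    intro c (hc : c < val r)
    obtain ⟨n, hn⟩ := exists_wt_lt (z := (val r - c) / 3) (by linarith)
    exact ⟨n, by linarith [close r n hr]⟩
  refine ⟨.inl ⟨rfl, real⟩, fun x hx hpx hxq => .inr (.inr ⟨rfl, rfl, ?_⟩), fun e he hub => ?_⟩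
  · rw [rle_iff (hf.1 x hx) real]
    by_contra hlt
    obtain ⟨r, hr, hr'⟩ := hU.exists_mem hx hpx hxq (not_le.1 hlt)
    exact (le r hr).not_gt hr'
  · rcases he with ⟨he, he'⟩ | he | he
    · refine .inr (.inr ⟨rfl, he, ?_⟩)
      rw [rle_iff real he']
      by_contra hlt
      obtain ⟨c, hc, hc'⟩ := exists_ratCut_between (not_le.1 hlt)
      obtain ⟨r, rfl⟩ := exists_val c
      obtain ⟨x, hx, hpx, hxq, hn⟩ := hU.exists_value hf (mem r hc') he' hc.le
      rcases hub x hx hpx hxq with h | h | h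
      · exact absurd (show (0 : M.El nat) = 1 + 1 from h) (by norm_num)
      · exact absurd (he.symm.trans h) (by norm_num)
      · exact absurd h.2.2 hn
    · exact .inr (.inl he)
    · obtain ⟨r, -, hr, -⟩ := hs 0
      obtain ⟨x, hx, hpx, hxq, -⟩ := hU.exists_value hf hr (isReal_toReal r) (cut_toReal r).le
      rcases hub x hx hpx hxq with h | h | h
      · exact absurd (show (0 : M.El nat) = 1 + 1 from h) (by norm_num)
      · exact absurd (he.symm.trans h) (by norm_num)
      · exact absurd (he.symm.trans h.2.1) (by norm_num)

end

/-- `BOOT` yields the set of all `(p, q, r)` such that `f` has a value above `r` on `[p, q]`; the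
suprema are arithmetical in this set. -/
theorem supPrinciple_of_boot (hB : BOOT M) {D : Set (M.El one)} (hD : IsDomainSet D)
    (Γ : M.El (one ⇒ one) → Prop) : SupPrinciple D Γ := by
  intro f hf _
  obtain ⟨d, hd⟩ := hD.decider
  obtain ⟨Y, hY⟩ := exists_decider₂ (M := M) (fun (x : M.El one) (n : M.El nat) =>
    ∃ p q r, n = pair (pair p q) r ∧ d ⬝ x = 0 ∧ RLE (M.combK nat nat ⬝ p) x ∧
      RLE x (M.combK nat nat ⬝ q) ∧ RLT (M.combK nat nat ⬝ r) (f ⬝ x))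
  obtain ⟨X, hX⟩ := hB Y
  have hU : ∀ p q : Frac M,
      IsBelowSet D f p q (fun m => X ⬝ pair (pair p.code q.code) m = 1) := fun p q r => by
    refine (hX _).2.trans ?_
    simp only [hY]
    constructor
    · rintro ⟨x, p', q', r', h, hx, hpx, hxq, hr⟩
      obtain ⟨h', rfl⟩ := pair_inj h
      obtain ⟨rfl, rfl⟩ := pair_inj h'
      have hx := (hd x).1 hx
      refine ⟨x, hx, hpx, hxq, ?_⟩
      rw [← cut_toReal]
      exact (rlt_iff (isReal_toReal r) (hf.1 x hx)).1 hr
    · rintro ⟨x, hx, hpx, hxq, hr⟩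
      refine ⟨x, _, _, _, rfl, (hd x).2 hx, hpx, hxq, ?_⟩
      rw [← cut_toReal] at hr
      exact (rlt_iff (isReal_toReal r) (hf.1 x hx)).2 hr
  classical
  -- the supremum is `-∞`, `+∞` or real if no, every or some but not every rational is below a
  -- value of `f`; its `n`-th approximation is a rational `r` of the set with `r + 2 ^ (-n)` outside
  obtain ⟨t, ht⟩ := exists_fun₂ (M := M) (fun (p q : M.El nat) =>
    (if ∃ r : Frac M, X ⬝ pair (pair p q) r.code = 1 then
      if ∀ r : Frac M, X ⬝ pair (pair p q) r.code = 1 then 1 else 0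
    else 1 + 1 : M.El nat))
  obtain ⟨s, hs⟩ := exists_fun₃ (M := M) (fun p q n => least (fun m => ∃ r : Frac M,
    m = r.code ∧ X ⬝ pair (pair p q) r.code = 1 ∧
      ¬ X ⬝ pair (pair p q) (r + invTwoPow n).code = 1))
  refine ⟨t, s, fun p q _ _ => ?_⟩
  rw [ht]
  split_ifs with h h'
  · exact isSupremum_top (hU p q) hf h' _
  · refine isSupremum_real (hU p q) hf fun n => ?_
    have := least_spec (fun m => ∃ r : Frac M,
      m = r.code ∧ X ⬝ pair (pair p.code q.code) r.code = 1 ∧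
        ¬ X ⬝ pair (pair p.code q.code) (r + invTwoPow n).code = 1)
      (by
        obtain ⟨r, hr, hr'⟩ := exists_boundary
          (fun m => X ⬝ pair (pair p.code q.code) m = 1)
          (fun r r' hle hr => by
            obtain ⟨x, hx, hpx, hxq, h'⟩ := (hU p q _).1 hr
            refine (hU p q _).2 ?_
            exact ⟨x, hx, hpx, hxq, (ratCut_le_ratCut.2 hle).trans_lt h'⟩)
          h (not_forall.1 h') n
        exact ⟨_, r, rfl, hr, hr'⟩)
    rw [← hs] at this
    exact this
  · exact isSupremum_bot (hU p q) hf h _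

end Suprema

/-! ### Coding number sequences by irrational numbers -/

section Coding

open Frac

variable {M : TypeStructure.{u}} [hM : Fact M.IsACA₀ω]

variable (M) in
/-- The number `4 ^ n - 1`. -/
def fourPowPred (n : M.El nat) : M.El nat :=
  twoPowPred M n * twoPowPred M n + (twoPowPred M n + twoPowPred M n)

instance {C : Type u} [Ctx M C] (n : C → M.El nat) [Rep n] :
    Rep (fun c => fourPowPred M (n c)) := by
  unfold fourPowPred; infer_instance

theorem val_fourPow (a n : M.El nat) : val ⟨a, 0, fourPowPred M n⟩ = toField a * wt n ^ 2 := by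
  have : toField (fourPowPred M n) + 1 = (toField (twoPowPred M n) + 1) ^ 2 := by
    simp only [fourPowPred, map_add, map_mul]; ring
  rw [val, this, wt_eq, map_zero, sub_zero, inv_pow, div_eq_mul_inv]

/-- The `j`-th digit in the base `4` expansion of `x + r` is `1`, where `x` is the real number with
the cut `S`.  Translating the real number by a rational just amounts to changing `r`. -/
def DigitOne (S : LowerSet (RatField M)) (r : RatField M) (j : M.El nat) : Prop :=
  ∃ z : M.El nat, ratCut ((4 * toField z + 1) * wt (j + 1) ^ 2 - r) ≤ S ∧
    S < ratCut ((4 * toField z + 2) * wt (j + 1) ^ 2 - r)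

theorem digitOne_iff {x : M.El one} (hx : IsReal x) (r : Frac M) (j : M.El nat) :
    DigitOne (cut x) (val r) j ↔
      ∃ z, RLE (toReal (⟨4 * z + 1, 0, fourPowPred M (j + 1)⟩ - r)) x ∧
        RLT x (toReal (⟨4 * z + 2, 0, fourPowPred M (j + 1)⟩ - r)) := by
  refine exists_congr fun z => ?_
  rw [rle_iff (isReal_toReal _) hx, rlt_iff hx (isReal_toReal _), cut_toReal, cut_toReal, val_sub,
    val_sub, val_fourPow, val_fourPow]
  simp only [map_add, map_mul, map_one, map_ofNat]

theorem IsTranslate.digitOne {x y : M.El one} {t : RatField M} (h : IsTranslate x y t)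
    (r : RatField M) (j : M.El nat) : DigitOne (cut y) r j ↔ DigitOne (cut x) (r + t) j := by
  refine exists_congr fun z => ?_
  rw [← not_lt, ← not_lt, h.cut_lt, h.cut_lt, sub_sub, sub_sub]

/-- Every sequence of digits `0` and `1` is the base `4` expansion of a real number. -/
theorem exists_real_of_digits (B : M.El one) (hB : ∀ j, B ⬝ j = 0 ∨ B ⬝ j = 1) :
    ∃ y, IsReal y ∧ ∀ j, DigitOne (cut y) 0 j ↔ B ⬝ j = 1 := by
  -- `a n` is the number with the first `n` digits
  obtain ⟨z, hz⟩ := exists_fun₂ (M := M) (fun b n => 4 * b + B ⬝ n)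
  obtain ⟨a, ha⟩ := exists_fun (M := M) (fun n => M.recR ⬝ n ⬝ 0 ⬝ z)
  have a_succ : ∀ n, a ⬝ (n + 1) = 4 * (a ⬝ n) + B ⬝ n := fun n => by
    rw [ha, ← succ_eq, hM.out.recR_succ, hz, ← ha]
  obtain ⟨y, hy⟩ := exists_fun (M := M) (fun n => code ⟨a ⬝ n, 0, fourPowPred M n⟩)
  have hA : ∀ n, approx y n = toField (a ⬝ n) * wt n ^ 2 := fun n => by
    rw [approx_eq (hy n), val_fourPow]
  have hB' : ∀ n, 0 ≤ toField (B ⬝ n) ∧ toField (B ⬝ n) ≤ 1 := fun n => by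
    rcases hB n with h | h <;> simp [h]
  -- the approximations increase, and their distance to the later ones is at most `4 ^ (-n) / 3`
  have lower' : ∀ n i, ¬ (⟨a ⬝ (n + i), 0, fourPowPred M (n + i)⟩ : Frac M) <
      ⟨a ⬝ n, 0, fourPowPred M n⟩ := fun n i =>
    nat_induction (fun i => ¬ (⟨a ⬝ (n + i), 0, fourPowPred M (n + i)⟩ : Frac M) <
      ⟨a ⬝ n, 0, fourPowPred M n⟩) (by rw [add_zero, lt_iff]; exact lt_irrefl _) (fun i hi => by
        rw [lt_iff, not_lt, val_fourPow, val_fourPow] at hi ⊢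
        rw [← add_assoc, a_succ, wt_succ, map_add, map_mul, map_ofNat]
        nlinarith [(hB' (n + i)).1, sq_nonneg (wt (n + i)),
          mul_nonneg (hB' (n + i)).1 (sq_nonneg (wt (n + i)))]) i
  have upper' : ∀ n i, ¬ (⟨3 * (a ⬝ n) + 1, 0, fourPowPred M n⟩ : Frac M) <
      ⟨3 * (a ⬝ (n + i)) + 1, 0, fourPowPred M (n + i)⟩ := fun n i =>
    nat_induction (fun i => ¬ (⟨3 * (a ⬝ n) + 1, 0, fourPowPred M n⟩ : Frac M) <
      ⟨3 * (a ⬝ (n + i)) + 1, 0, fourPowPred M (n + i)⟩)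
      (by rw [add_zero, lt_iff]; exact lt_irrefl _) (fun i hi => by
        rw [lt_iff, not_lt, val_fourPow, val_fourPow] at hi ⊢
        rw [← add_assoc, a_succ, wt_succ]
        simp only [map_add, map_mul, map_ofNat, map_one] at hi ⊢
        nlinarith [(hB' (n + i)).2, sq_nonneg (wt (n + i)),
          mul_nonneg (sub_nonneg.2 (hB' (n + i)).2) (sq_nonneg (wt (n + i)))]) i
  have lower : ∀ n m, n ≤ m → approx y n ≤ approx y m := fun n m h => by
    obtain ⟨i, rfl⟩ := (nat_le_iff _ _).1 h
    have := lower' n i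
    rw [lt_iff, not_lt, val_fourPow, val_fourPow] at this
    rwa [hA, hA]
  have upper : ∀ n m, n ≤ m → approx y m ≤ approx y n + wt n ^ 2 / 3 := fun n m h => by
    obtain ⟨i, rfl⟩ := (nat_le_iff _ _).1 h
    have := upper' n i
    rw [lt_iff, not_lt, val_fourPow, val_fourPow] at this
    simp only [map_add, map_mul, map_ofNat, map_one] at this
    rw [hA, hA]
    nlinarith [sq_nonneg (wt (n + i))]
  have real : IsReal y := by
    refine (isReal_iff y).2 ⟨fun n => ⟨_, hy n⟩, fun n m h => ?_⟩
    have h1 := lower n m h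
    have h2 := upper n m h
    have h3 := wt_pos n
    have h4 : wt n ≤ 1 := wt_zero (M := M) ▸ wt_anti zero_le
    rw [abs_lt]
    constructor <;> nlinarith
  have cut_lower : ∀ n, ratCut (approx y n) ≤ cut y := fun n c (hc : c < approx y n) => by
    obtain ⟨m, hm, hm'⟩ := exists_wt_lt_ge (z := (approx y n - c) / 2) (by linarith) n
    exact ⟨m, by linarith [lower n m hm]⟩
  have cut_upper : ∀ n, cut y < ratCut (approx y n + wt n ^ 2) := fun n => by
    have hn := wt_pos n
    refine lt_ratCut_iff.2 ⟨approx y n + wt n ^ 2 / 2, by nlinarith, ?_⟩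
    rintro ⟨m, hm⟩
    have := wt_pos m
    rcases le_total n m with h | h
    · nlinarith [upper n m h]
    · nlinarith [lower m n h]
  refine ⟨y, real, fun j => ?_⟩
  have hq : 0 < wt (j + 1) ^ 2 := pow_pos (wt_pos _) 2
  have h1 := cut_lower (j + 1)
  have h2 := cut_upper (j + 1)
  rw [hA, a_succ, map_add, map_mul, map_ofNat] at h1 h2
  constructor
  · rintro ⟨z, hz1, hz2⟩
    rw [sub_zero] at hz1 hz2
    have h3 := ratCut_lt_ratCut.1 (hz1.trans_lt h2)
    have h4 := ratCut_lt_ratCut.1 (h1.trans_lt hz2)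
    rw [← add_one_mul] at h3
    have h3 := lt_of_mul_lt_mul_right h3 hq.le
    have h4 := lt_of_mul_lt_mul_right h4 hq.le
    refine (hB j).resolve_left fun h0 => ?_
    rw [h0, map_zero, add_zero] at h3 h4
    have h5 : z < a ⬝ j := toField_lt.1 (by linarith)
    have h6 := toField_le.2 ((nat_add_one_le _ _).2 h5)
    rw [map_add, map_one] at h6
    linarith
  · intro h
    rw [h, map_one] at h1 h2
    exact ⟨a ⬝ j, by rwa [sub_zero], by convert h2 using 2; ring⟩

open Classical in
/-- The sequence `h` that is decoded from the real number `x + r`, where `x` has the cut `S`: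
`h i` is the least `v` such that the digit of `x + r` with index `2 * pair i v` is `1`. -/
noncomputable def decode (S : LowerSet (RatField M)) (r : RatField M) : M.El one :=
  if h : ∃ g : M.El one, ∀ i, g ⬝ i = least (fun v => DigitOne S r (2 * pair i v)) then h.choose
  else dflt M one

theorem decode_eq {S : LowerSet (RatField M)} {r : RatField M} {g : M.El one}
    (h : ∀ i, g ⬝ i = least (fun v => DigitOne S r (2 * pair i v))) : decode S r = g := by
  have h' : ∃ g : M.El one, ∀ i, g ⬝ i = least (fun v => DigitOne S r (2 * pair i v)) := ⟨g, h⟩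
  rw [decode, dif_pos h']
  exact hM.out.extensionality _ _ fun i => (h'.choose_spec i).trans (h i).symm

set_option synthInstance.maxHeartbeats 400000 in
set_option synthInstance.maxSize 1000 in
theorem exists_decoder : ∃ R : M.El (one ⇒ nat ⇒ nat ⇒ nat ⇒ one), ∀ x, IsReal x → ∀ r : Frac M,
    R ⬝ x ⬝ r.pos ⬝ r.neg ⬝ r.den = decode (cut x) (val r) := by
  obtain ⟨ψ, hψ, hψ'⟩ := Rep.curry
    (fun c : ((((PUnit.{u + 1} × M.El one) × M.El nat) × M.El nat) × M.El nat) × M.El nat =>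
      least (fun v => ∃ z, RLE (toReal (⟨4 * z + 1, 0, fourPowPred M (2 * pair c.2 v + 1)⟩ -
          ⟨c.1.1.1.2, c.1.1.2, c.1.2⟩)) c.1.1.1.1.2 ∧
        RLT c.1.1.1.1.2 (toReal (⟨4 * z + 2, 0, fourPowPred M (2 * pair c.2 v + 1)⟩ -
          ⟨c.1.1.1.2, c.1.1.2, c.1.2⟩))))
  obtain ⟨R, hR⟩ := hψ.out
  refine ⟨R, fun x hx r => (decode_eq fun i => ?_).symm⟩
  have h1 : R ⬝ x ⬝ r.pos ⬝ r.neg ⬝ r.den = ψ ((((PUnit.unit, x), r.pos), r.neg), r.den) :=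
    hR ((((PUnit.unit, x), r.pos), r.neg), r.den)
  rw [h1, hψ']
  simp only [digitOne_iff hx]

set_option synthInstance.maxHeartbeats 400000 in
set_option synthInstance.maxSize 1000 in
/-- Every sequence is decoded from an irrational number.  The digits with odd index make sure that
the number is irrational, by diagonalization. -/
theorem exists_irrational_decode (h : M.El one) : ∃ y, IsReal y ∧ (∀ c, cut y ≠ ratCut c) ∧
    ∀ j, ∀ i v, j = 2 * pair i v → (DigitOne (cut y) 0 j ↔ h ⬝ i = v) := by
  obtain ⟨F, hF⟩ := exists_decider (M := M) (fun k => ∃ z,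
    RLE (toReal (⟨4 * z + 1, 0, fourPowPred M (2 * k + 1 + 1)⟩ - 0)) (M.combK nat nat ⬝ k) ∧
      RLT (M.combK nat nat ⬝ k) (toReal (⟨4 * z + 2, 0, fourPowPred M (2 * k + 1 + 1)⟩ - 0)))
  classical
  obtain ⟨B, hB⟩ := exists_fun (M := M) (fun j => (if (∃ i v, j = 2 * pair i v ∧ h ⬝ i = v) ∨
    (∃ k, j = 2 * k + 1 ∧ ¬ F ⬝ k = 0) then 1 else 0 : M.El nat))
  have hB' : ∀ j, B ⬝ j = 1 ↔ (∃ i v, j = 2 * pair i v ∧ h ⬝ i = v) ∨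
      (∃ k, j = 2 * k + 1 ∧ ¬ F ⬝ k = 0) := fun j => by
    rw [hB]; split_ifs with h
    · exact iff_of_true rfl h
    · exact iff_of_false zero_ne_one h
  -- even indices code the graph of `h`, odd indices the diagonalization
  have parity : ∀ a b : M.El nat, 2 * a ≠ 2 * b + 1 := fun a b hab => by
    have hab := congrArg toField hab
    simp only [map_add, map_mul, map_ofNat, map_one] at hab
    rcases le_or_gt a b with hle | hlt
    · have := toField_le.2 hle
      linarith
    · have := toField_le.2 ((nat_add_one_le _ _).2 hlt)
      rw [map_add, map_one] at this
      linarith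
  obtain ⟨y, hy, hd⟩ := exists_real_of_digits B (fun j => by
    rw [hB]; split_ifs
    · exact .inr rfl
    · exact .inl rfl)
  have two_inj : ∀ a b : M.El nat, 2 * a = 2 * b → a = b := fun a b hab =>
    mul_left_cancel₀ two_ne_zero hab
  refine ⟨y, hy, ?_, ?_⟩
  · intro c hc
    obtain ⟨p, rfl⟩ := exists_val c
    have h1 := (hd (2 * p.code + 1)).trans (hB' _)
    rw [hc, ← cut_toReal p, ← val_zero, digitOne_iff (isReal_toReal p)] at h1
    have h2 := h1.trans (or_iff_right fun ⟨i, v, h, _⟩ => parity _ _ h.symm)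
    have h3 := hF p.code
    by_cases hp : F ⬝ p.code = 0
    · obtain ⟨k, hk, hk'⟩ := h2.1 (h3.1 hp)
      rw [two_inj _ _ (add_right_cancel hk)] at hp
      exact hk' hp
    · exact hp (h3.2 (h2.2 ⟨_, rfl, hp⟩))
  · rintro _ i v rfl
    rw [hd, hB']
    constructor
    · rintro (⟨i', v', h1, h2⟩ | ⟨k, h1, -⟩)
      · obtain ⟨rfl, rfl⟩ := pair_inj (two_inj _ _ h1)
        exact h2
      · exact absurd h1 (parity _ _)
    · exact fun h1 => .inl ⟨i, v, rfl, h1⟩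

end Coding

/-! ### Functions whose level sets are locally invariant under rational translations -/

section LevelSets

open Frac

variable {M : TypeStructure.{u}} [hM : Fact M.IsACA₀ω]

/-- The function `f : ℝ → {0, 1}` vanishes on the rationals, and around every real number `x` there
is an interval `(lo, hi)` in which `f` takes the value `f x` at all rational translates of some real
number `b`. -/
structure IsLocallyTranslationStable (f : M.El (one ⇒ one)) : Prop where
  values : ∀ x, IsReal x → f ⬝ x = toReal 0 ∨ f ⬝ x = toReal 1
  congr : ∀ x y, IsReal x → IsReal y → cut x = cut y → f ⬝ x = f ⬝ y
  rat : ∀ x c, IsReal x → cut x = ratCut c → f ⬝ x = toReal 0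
  level : ∀ x, IsReal x → ∃ (b : M.El one) (lo hi : RatField M), IsReal b ∧
    ratCut lo < cut x ∧ cut x < ratCut hi ∧ ∀ y r, IsTranslate b y r → ratCut lo < cut y →
      cut y < ratCut hi → f ⬝ y = f ⬝ x

theorem near_refl {x : M.El one} (hx : IsReal x) (k : M.El nat) : Near k x x := by
  obtain ⟨c, d, h1, h2, h3⟩ := hx.exists_bounds (wt_pos k)
  exact (near_iff hx hx k).2 ⟨c, d, h3, ⟨h1, h2⟩, h1, h2⟩

/-- A neighbourhood of `x` inside a rational interval around `x`. -/
theorem exists_near_subset {x : M.El one} (hx : IsReal x) {lo hi : RatField M}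
    (hlo : ratCut lo < cut x) (hhi : cut x < ratCut hi) :
    ∃ k, ∀ y, IsReal y → Near k x y → ratCut lo < cut y ∧ cut y < ratCut hi := by
  obtain ⟨c, hc, hcx⟩ := exists_ratCut_between hlo
  obtain ⟨p, rfl⟩ := exists_val hi
  rw [← cut_toReal] at hhi
  obtain ⟨d, hxd, hd⟩ := exists_ratCut_between hhi
  rw [cut_toReal] at hd
  have hc := ratCut_lt_ratCut.1 hc
  have hd := ratCut_lt_ratCut.1 hd
  obtain ⟨k, hk⟩ := exists_wt_lt (z := min (c - lo) (val p - d))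
    (lt_min (sub_pos.2 hc) (sub_pos.2 hd))
  obtain ⟨hk1, hk2⟩ := lt_min_iff.1 hk
  refine ⟨k, fun y hy h => ?_⟩
  obtain ⟨e, e', he, ⟨h1, h2⟩, h3, h4⟩ := (near_iff hx hy k).1 h
  have h5 := ratCut_lt_ratCut.1 (hcx.trans h2)
  have h6 := ratCut_lt_ratCut.1 (h1.trans hxd)
  exact ⟨(ratCut_le_ratCut.2 (by linarith)).trans_lt h3,
    h4.trans_le (ratCut_le_ratCut.2 (by linarith))⟩

/-- Two rationals just below a real number. -/
theorem exists_interval_lt {x : M.El one} {S : LowerSet (RatField M)} (h : S < cut x) :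
    ∃ c d : Frac M, S < ratCut (val c) ∧ val c < val d ∧ ratCut (val d) < cut x := by
  obtain ⟨c, hc, hc'⟩ := exists_ratCut_between h
  obtain ⟨d, hd, hd'⟩ := exists_ratCut_between hc'
  obtain ⟨c, rfl⟩ := exists_val c
  obtain ⟨d, rfl⟩ := exists_val d
  exact ⟨c, d, hc, ratCut_lt_ratCut.1 hd, hd'⟩

/-- Every open interval contains a rational translate of a given real number. -/
theorem exists_translate_between {b : M.El one} (hb : IsReal b) {c d : RatField M} (h : c < d) :
    ∃ r, ratCut (c - r) < cut b ∧ cut b < ratCut (d - r) := by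
  obtain ⟨c', d', h1, h2, h3⟩ := hb.exists_bounds (sub_pos.2 h)
  refine ⟨c - c', by rwa [sub_sub_cancel], h2.trans_le (ratCut_le_ratCut.2 (by linarith))⟩

section

variable {D : Set (M.El one)} (hD : IsDomainSet D)

include hD

/-- Near every point of `D` there is an open interval inside `D`. -/
theorem IsDomainSet.exists_interval {y : M.El one} (hy : y ∈ D) {lo hi : RatField M}
    (hlo : ratCut lo < cut y) (hhi : cut y < ratCut hi) (k : M.El nat) :
    ∃ c d : RatField M, c < d ∧ lo ≤ c ∧ d ≤ hi ∧ ∀ y', IsReal y' → ratCut c < cut y' →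
      cut y' < ratCut d → y' ∈ D ∧ Near k y y' := by
  have hyr := hD.isReal y hy
  obtain ⟨e, e', he, he', hee⟩ := hyr.exists_bounds (wt_pos k)
  by_cases h0 : ratCut 0 < cut y
  · obtain ⟨c, d, hc, hcd, hd⟩ := exists_interval_lt (max_lt h0 (max_lt hlo he))
    obtain ⟨hc0, hc⟩ := max_lt_iff.1 hc
    obtain ⟨hc1, hc2⟩ := max_lt_iff.1 hc
    refine ⟨_, _, hcd, (ratCut_lt_ratCut.1 hc1).le, (ratCut_lt_ratCut.1 (hd.trans hhi)).le,
      fun y' hy' h1 h2 => ⟨hD.convex _ hD.zero_mem _ hy _ hy' ?_ (h2.trans hd).le,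
        (near_iff hyr hy' k).2 ⟨e, e', hee, ⟨he, he'⟩, hc2.trans h1, h2.trans (hd.trans he')⟩⟩⟩
    rw [cut_toReal, val_zero]
    exact (hc0.trans h1).le
  · obtain ⟨p, hp⟩ := exists_val (min 1 (min hi e'))
    have hyp : cut y < cut p.toReal := by
      rw [cut_toReal, hp]
      have h1 : cut y < ratCut 1 := (not_lt.1 h0).trans_lt (ratCut_lt_ratCut.2 one_pos)
      rcases min_choice 1 (min hi e') with h | h <;> rw [h]
      · exact h1
      · rcases min_choice hi e' with h | h <;> rw [h]
        · exact hhi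
        · exact he'
    obtain ⟨c, d, hc, hcd, hd⟩ := exists_interval_lt hyp
    rw [cut_toReal, hp, ratCut_lt_ratCut, lt_min_iff, lt_min_iff] at hd
    refine ⟨_, _, hcd, (ratCut_lt_ratCut.1 (hlo.trans hc)).le, hd.2.1.le,
      fun y' hy' h1 h2 => ⟨hD.convex _ hy _ hD.one_mem _ hy' (hc.trans h1).le ?_,
        (near_iff hyr hy' k).2 ⟨e, e', hee, ⟨he, he'⟩, he.trans (hc.trans h1),
          h2.trans (ratCut_lt_ratCut.2 hd.2.2)⟩⟩⟩
    rw [cut_toReal, val_one]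
    exact (h2.trans (ratCut_lt_ratCut.2 hd.1)).le

theorem IsDomainSet.exists_rat_near {x : M.El one} (hx : x ∈ D) (k : M.El nat) :
    ∃ p : Frac M, p.toReal ∈ D ∧ Near k x p.toReal := by
  obtain ⟨e, e', he, he', -⟩ := (hD.isReal x hx).exists_bounds (wt_pos k)
  obtain ⟨c, d, hcd, -, -, h⟩ := hD.exists_interval hx he he' k
  obtain ⟨p, hp⟩ := exists_val ((c + d) / 2)
  refine ⟨p, h _ (isReal_toReal p) ?_ ?_⟩ <;> rw [cut_toReal, hp, ratCut_lt_ratCut] <;> linarith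

end

omit hM in
theorem mem_points_of_eq {G : M.El two} {x y : M.El one} (h : x = y)
    (hx : x ∈ points (Line M) G) : y ∈ points (Line M) G := h ▸ hx

namespace IsLocallyTranslationStable

variable {f : M.El (one ⇒ one)} (hf : IsLocallyTranslationStable f)

include hf

theorem isReal_apply {x : M.El one} (hx : IsReal x) : IsReal (f ⬝ x) := by
  rcases hf.values x hx with h | h <;> rw [h] <;> exact isReal_toReal _

theorem isFun {D E : Set (M.El one)} (hD : IsDomainSet D) (hE : IsDomainSet E) : IsFun D E f := by
  refine ⟨fun x hx => ?_, fun x hx y hy h => ?_⟩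
  · rcases hf.values x (hD.isReal x hx) with h | h <;> rw [h]
    exacts [hE.zero_mem, hE.one_mem]
  · have hxr := hD.isReal x hx
    have hyr := hD.isReal y hy
    rw [hf.congr x y hxr hyr ((req_iff hxr hyr).1 h), req_iff (hf.isReal_apply hyr)
      (hf.isReal_apply hyr)]

/-- Around `x`, the level set of `f x` is dense. -/
theorem exists_mem_level {x : M.El one} (hx : IsReal x) : ∃ lo hi : RatField M,
    ratCut lo < cut x ∧ cut x < ratCut hi ∧ ∀ c d, c < d → lo ≤ c → d ≤ hi →
      ∃ y, IsReal y ∧ ratCut c < cut y ∧ cut y < ratCut d ∧ f ⬝ y = f ⬝ x := by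
  obtain ⟨b, lo, hi, hb, hlo, hhi, h⟩ := hf.level x hx
  refine ⟨lo, hi, hlo, hhi, fun c d hcd hc hd => ?_⟩
  obtain ⟨r, h1, h2⟩ := exists_translate_between hb hcd
  obtain ⟨y, hy⟩ := exists_translate hb r
  rw [← hy.lt_cut] at h1
  rw [← hy.cut_lt] at h2
  exact ⟨y, hy.isReal_right, h1, h2, h y r hy ((ratCut_le_ratCut.2 hc).trans_lt h1)
    (h2.trans_le (ratCut_le_ratCut.2 hd))⟩

theorem graphContinuous {D : Set (M.El one)} (hD : IsDomainSet D) : GraphContinuous D f := by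
  have hg : ∀ x, M.combK one one ⬝ toReal 0 ⬝ x = toReal 0 := fun x => hM.out.combK_eq _ _
  refine ⟨M.combK one one ⬝ toReal 0, ⟨⟨fun x _ => ?_, fun x _ y _ _ => ?_⟩,
    fun x _ k => ⟨0, fun y _ _ => ?_⟩⟩, ?_⟩
  · rw [hg]; exact isReal_toReal 0
  · rw [hg, hg, req_iff (isReal_toReal 0) (isReal_toReal 0)]
  · rw [hg, hg]; exact near_refl (isReal_toReal 0) k
  · rintro ⟨x, y⟩ ⟨hx, hy, h⟩
    rw [hg, req_iff (isReal_toReal 0) hy] at h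
    refine ⟨hD.isReal x hx, hy, fun k => ?_⟩
    obtain ⟨p, hp, hxp⟩ := hD.exists_rat_near hx k
    refine ⟨(p.toReal, toReal 0), ⟨hp, isReal_toReal 0, ?_⟩, hxp, ?_⟩
    · rw [hf.rat _ _ (isReal_toReal p) (cut_toReal p), req_iff (isReal_toReal 0) (isReal_toReal 0)]
    · have := near_refl (isReal_toReal (0 : Frac M)) k
      rw [near_iff (isReal_toReal 0) (isReal_toReal 0)] at this
      rw [near_iff hy (isReal_toReal 0), ← h]
      exact this

theorem preContinuous {D : Set (M.El one)} (hD : IsDomainSet D) : PreContinuous D f := by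
  rintro G - x ⟨hx, hG⟩
  have hxr := hD.isReal x hx
  obtain ⟨lo, hi, hlo, hhi, h⟩ := hf.exists_mem_level hxr
  obtain ⟨k, hk⟩ := exists_near_subset hxr hlo hhi
  refine ⟨hx, k, fun y hy hxy => ⟨hy, fun l => ?_⟩⟩
  obtain ⟨h1, h2⟩ := hk y (hD.isReal y hy) hxy
  obtain ⟨c, d, hcd, hc, hd, h3⟩ := hD.exists_interval hy h1 h2 l
  obtain ⟨z, hz, hcz, hzd, hfz⟩ := h c d hcd hc hd
  obtain ⟨hzD, hyz⟩ := h3 z hz hcz hzd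
  exact ⟨z, hzD, ⟨hzD, mem_points_of_eq hfz.symm hG⟩, hyz⟩

theorem husainAlmostContinuous {D : Set (M.El one)} (hD : IsDomainSet D) :
    HusainAlmostContinuous D f :=
  fun _ hx G hG hxG => hf.preContinuous hD G hG ⟨hx, hxG⟩

theorem cContinuous {D : Set (M.El one)} (hD : IsDomainSet D) : CContinuous D f := by
  intro G hG
  obtain ⟨O, hO⟩ := exists_fun (M := M) (fun _ : M.El one => (1 : M.El nat))
  obtain ⟨A, hA⟩ := exists_fun (M := M) (fun x : M.El one => G ⬝ (f ⬝ x))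
  have hpO : points D O = D := Set.ext fun x => ⟨fun h => h.1, fun h => ⟨h, hO x⟩⟩
  have hpA : preimageIn D f G = points D A := Set.ext fun x =>
    ⟨fun h => ⟨h.1, (hA x).trans h.2.2⟩,
      fun h => ⟨h.1, hf.isReal_apply (hD.isReal x h.1), (hA x).symm.trans h.2⟩⟩
  refine ⟨O, A, ⟨⟨fun x _ => .inr (hO x), fun x _ y _ _ => (hO x).trans (hO y).symm⟩, ?_⟩,
    ⟨fun x hx => ?_, fun x hx y hy h => ?_⟩, ?_, ?_⟩
  · rw [hpO]
    exact fun x hx => ⟨hx, 0, fun y hy _ => hy⟩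
  · rw [hA]
    exact hG.1.1 _ (hf.isReal_apply (hD.isReal x hx))
  · have hxr := hD.isReal x hx
    have hyr := hD.isReal y hy
    rw [hA, hA, hf.congr x y hxr hyr ((req_iff hxr hyr).1 h)]
  · rw [← hpA]
    exact hf.preContinuous hD G hG
  · rw [hpO, hpA]
    exact (Set.inter_eq_right.2 fun x hx => hx.1).symm

theorem not_cesaroType {D : Set (M.El one)} (hD : IsDomainSet D) : ¬ CesaroType D f := by
  rintro ⟨U, V, -, ⟨x, hx⟩, hV, ⟨v, hv⟩, h⟩
  obtain ⟨hvr, k, hk⟩ := hV.2 hv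
  obtain ⟨c, d, h1, h2, h3⟩ := IsReal.exists_bounds hvr (wt_pos k)
  have hcd : c < d := ratCut_lt_ratCut.1 (h1.trans h2)
  -- one of three rationals in `V` is neither `0` nor `1`
  obtain ⟨e, hce, hed, he0, he1⟩ : ∃ e, c < e ∧ e < d ∧ e ≠ 0 ∧ e ≠ 1 := by
    by_contra! hne
    have a1 := hne (c + (d - c) / 4) (by linarith) (by linarith)
    have a2 := hne (c + (d - c) / 2) (by linarith) (by linarith)
    have a3 := hne (c + (d - c) * 3 / 4) (by linarith) (by linarith)
    by_cases b1 : c + (d - c) / 4 = 0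
    · by_cases b2 : c + (d - c) / 2 = 0
      · linarith
      · have := a2 b2
        have := a3 (by linarith)
        linarith
    · have := a1 b1
      by_cases b2 : c + (d - c) / 2 = 0
      · linarith
      · linarith [a2 b2]
  obtain ⟨p, rfl⟩ := exists_val e
  have hp : p.toReal ∈ points (Line M) V := by
    refine hk _ (isReal_toReal p) ((near_iff hvr (isReal_toReal p) k).2 ⟨c, d, h3, ⟨h1, h2⟩, ?_⟩)
    rw [cut_toReal, ratCut_lt_ratCut, ratCut_lt_ratCut]
    exact ⟨hce, hed⟩
  obtain ⟨-, h4⟩ := h _ hp hx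
  obtain ⟨y, -, ⟨hy, hyp⟩, -⟩ := h4 0
  have hyr := hD.isReal y hy
  rw [req_iff (hf.isReal_apply hyr) (isReal_toReal p), cut_toReal] at hyp
  rcases hf.values y hyr with h5 | h5 <;> rw [h5, cut_toReal] at hyp
  · exact he0 ((ratCut_le_ratCut.1 hyp.ge).antisymm (ratCut_le_ratCut.1 hyp.le) |>.trans val_zero)
  · exact he1 ((ratCut_le_ratCut.1 hyp.ge).antisymm (ratCut_le_ratCut.1 hyp.le) |>.trans val_one)

end IsLocallyTranslationStable

end LevelSets

/-! ### The Young condition and peripheral continuity -/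

section OneSided

open Frac

variable {M : TypeStructure.{u}} [hM : Fact M.IsACA₀ω]

/-- For prescribed small intervals `(c, d)` there is in `M` a sequence of rational translates of `b`
that belong to these intervals.  The condition `Q k c d` refers to the codes of `c` and `d`. -/
theorem exists_seq_translates {b : M.El one} (hb : IsReal b)
    (Q : M.El nat → M.El nat → M.El nat → Prop)
    [Dec M (fun c : ((PUnit.{u + 1} × M.El nat) × M.El nat) × M.El nat => Q c.1.1.2 c.1.2 c.2)]
    (h : ∀ k, ∃ c d : Frac M, val c < val d ∧ Q k c.code d.code) :
    ∃ s : M.El (nat ⇒ one), ∀ k, ∃ (c d : Frac M) (r : RatField M), Q k c.code d.code ∧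
      IsTranslate b (s ⬝ k) r ∧ ratCut (val c) < cut (s ⬝ k) ∧ cut (s ⬝ k) < ratCut (val d) := by
  obtain ⟨Q', hQ'⟩ := exists_decider₃ Q
  obtain ⟨G, hG⟩ := exists_decider₂ (M := M) (fun m n => ∃ c r : Frac M, m = c.code ∧ n = r.code ∧
    RLT (toReal (c - r)) b)
  obtain ⟨H, hH⟩ := exists_decider₂ (M := M) (fun m n => ∃ c r : Frac M, m = c.code ∧ n = r.code ∧
    RLT b (toReal (c - r)))
  obtain ⟨s, hs⟩ := exists_translates hb (fun k m => ∃ c d, (∃ p : Frac M, c = p.code) ∧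
    (∃ p : Frac M, d = p.code) ∧ Q' ⬝ k ⬝ c ⬝ d = 0 ∧ G ⬝ c ⬝ m = 0 ∧ H ⬝ d ⬝ m = 0) (fun k => by
      obtain ⟨c, d, hcd, hQ⟩ := h k
      obtain ⟨r, h1, h2⟩ := exists_translate_between hb hcd
      obtain ⟨r, rfl⟩ := exists_val r
      rw [← val_sub, ← cut_toReal] at h1 h2
      exact ⟨r, _, _, ⟨c, rfl⟩, ⟨d, rfl⟩, (hQ' _ _ _).2 hQ,
        (hG _ _).2 ⟨c, r, rfl, rfl, (rlt_iff (isReal_toReal _) hb).2 h1⟩,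
        (hH _ _).2 ⟨d, r, rfl, rfl, (rlt_iff hb (isReal_toReal _)).2 h2⟩⟩)
  refine ⟨s, fun k => ?_⟩
  obtain ⟨r, ⟨_, _, ⟨c, rfl⟩, ⟨d, rfl⟩, h1, h2, h3⟩, h4⟩ := hs k
  obtain ⟨c', r', hc, hr, h2⟩ := (hG _ _).1 h2
  obtain ⟨d', r'', hd, hr', h3⟩ := (hH _ _).1 h3
  rw [rlt_iff (isReal_toReal _) hb, ← code_injective hc, ← code_injective hr, cut_toReal,
    val_sub] at h2
  rw [rlt_iff hb (isReal_toReal _), ← code_injective hd, ← code_injective hr', cut_toReal,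
    val_sub] at h3
  exact ⟨c, d, val r, (hQ' _ _ _).1 h1, h4, (h4.lt_cut _).2 h2, (h4.cut_lt _).2 h3⟩

theorem near_of_between {x y z : M.El one} (hx : IsReal x) (hy : IsReal y) (hz : IsReal z)
    {k : M.El nat} (h : Near k x z)
    (h' : cut x ≤ cut y ∧ cut y ≤ cut z ∨ cut z ≤ cut y ∧ cut y ≤ cut x) : Near k y x := by
  obtain ⟨c, d, h1, ⟨h2, h3⟩, h4, h5⟩ := (near_iff hx hz k).1 h
  refine (near_iff hy hx k).2 ⟨c, d, h1, ?_, h2, h3⟩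
  rcases h' with h' | h'
  · exact ⟨h2.trans_le h'.1, h'.2.trans_lt h5⟩
  · exact ⟨h4.trans_le h'.1, h'.2.trans_lt h3⟩

theorem near_mono {x y : M.El one} (hx : IsReal x) (hy : IsReal y) {k n : M.El nat} (h : k ≤ n)
    (hn : Near n x y) : Near k x y := by
  obtain ⟨c, d, h1, h2⟩ := (near_iff hx hy n).1 hn
  exact (near_iff hx hy k).2 ⟨c, d, h1.trans_le (wt_anti h), h2⟩

theorem convergesTo_of_near {s : M.El (nat ⇒ one)} {x : M.El one} (hx : IsReal x)
    (hs : ∀ k, IsReal (s ⬝ k)) (h : ∀ k, Near k (s ⬝ k) x) : ConvergesTo (fun n => s ⬝ n) x :=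
  fun k => ⟨k, fun n hn => near_mono (hs n) hx hn (h n)⟩

/-- Two rationals just above a real number. -/
theorem exists_interval_gt {x : M.El one} {c : RatField M} (h : cut x < ratCut c) :
    ∃ d e : Frac M, cut x < ratCut (val d) ∧ val d < val e ∧ val e < c := by
  obtain ⟨p, rfl⟩ := exists_val c
  rw [← cut_toReal] at h
  obtain ⟨d, e, h1, h2, h3⟩ := exists_interval_lt h
  rw [cut_toReal, ratCut_lt_ratCut] at h3
  exact ⟨d, e, h1, h2, h3⟩

namespace IsLocallyTranslationStable

variable {f : M.El (one ⇒ one)} (hf : IsLocallyTranslationStable f) {D : Set (M.El one)}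
  (hD : IsDomainSet D)

include hf hD

theorem youngCondition : YoungCondition D f := by
  intro x hx
  have hxr := hD.isReal x hx
  obtain ⟨b, lo, hi, hb, hlo, hhi, hlevel⟩ := hf.level x hxr
  obtain ⟨lo, rfl⟩ := exists_val lo
  obtain ⟨hi, rfl⟩ := exists_val hi
  constructor
  · rintro ⟨z, hz, hzx⟩
    have hzr := hD.isReal z hz
    rw [rlt_iff hzr hxr] at hzx
    obtain ⟨s, hs⟩ := exists_seq_translates hb (fun k c d => RLT z (M.combK nat nat ⬝ c) ∧
      RLT (toReal lo) (M.combK nat nat ⬝ c) ∧ Near k x (M.combK nat nat ⬝ c) ∧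
      RLT (M.combK nat nat ⬝ d) x) (fun k => by
        obtain ⟨e, e', he, he', hee⟩ := hxr.exists_bounds (wt_pos k)
        obtain ⟨c, d, h1, h2, h3⟩ := exists_interval_lt (max_lt hzx (max_lt hlo he))
        obtain ⟨h4, h5⟩ := max_lt_iff.1 h1
        obtain ⟨h5, h6⟩ := max_lt_iff.1 h5
        refine ⟨c, d, h2, (rlt_iff hzr (isReal_toReal c)).2 ?_,
          (rlt_iff (isReal_toReal lo) (isReal_toReal c)).2 ?_,
          (near_iff hxr (isReal_toReal c) k).2 ⟨e, e', hee, ⟨he, he'⟩, ?_⟩,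
          (rlt_iff (isReal_toReal d) hxr).2 ?_⟩
        · rwa [cut_toReal]
        · rwa [cut_toReal, cut_toReal]
        · rw [cut_toReal]
          exact ⟨h6, (ratCut_lt_ratCut.2 h2).trans (h3.trans he')⟩
        · rwa [cut_toReal])
    have key : ∀ k, IsReal (s ⬝ k) ∧ cut z < cut (s ⬝ k) ∧ cut (s ⬝ k) < cut x ∧
        Near k (s ⬝ k) x ∧ f ⬝ (s ⬝ k) = f ⬝ x := fun k => by
      obtain ⟨c, d, r, ⟨h1, h2, h3, h4⟩, h5, h6, h7⟩ := hs k
      have h1 := (rlt_iff hzr (isReal_toReal c)).1 h1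
      have h2 := (rlt_iff (isReal_toReal lo) (isReal_toReal c)).1 h2
      have h4 := (rlt_iff (isReal_toReal d) hxr).1 h4
      rw [cut_toReal] at h1 h4
      rw [cut_toReal, cut_toReal] at h2
      have h8 := h7.trans h4
      exact ⟨h5.isReal_right, h1.trans h6, h8,
        near_of_between hxr h5.isReal_right (isReal_toReal c) h3
          (.inr ⟨(cut_toReal c).trans_le h6.le, h8.le⟩),
        hlevel _ r h5 (h2.trans h6) (h8.trans hhi)⟩
    refine ⟨s, fun n => ⟨?_, ?_⟩, convergesTo_of_near hxr (fun n => (key n).1)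
      (fun n => (key n).2.2.2.1), fun k => ⟨0, fun n _ => ?_⟩⟩
    · exact hD.convex z hz x hx _ (key n).1 (key n).2.1.le (key n).2.2.1.le
    · exact (rlt_iff (key n).1 hxr).2 (key n).2.2.1
    · simp only [(key n).2.2.2.2]
      exact near_refl (hf.isReal_apply hxr) k
  · rintro ⟨z, hz, hxz⟩
    have hzr := hD.isReal z hz
    rw [rlt_iff hxr hzr] at hxz
    obtain ⟨s, hs⟩ := exists_seq_translates hb (fun k c d => RLT (M.combK nat nat ⬝ d) z ∧
      RLT (M.combK nat nat ⬝ d) (toReal hi) ∧ Near k x (M.combK nat nat ⬝ d) ∧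
      RLT x (M.combK nat nat ⬝ c)) (fun k => by
        obtain ⟨e, e', he, he', hee⟩ := hxr.exists_bounds (wt_pos k)
        obtain ⟨w, hw, hwz⟩ := exists_ratCut_between hxz
        obtain ⟨c, d, h1, h2, h3⟩ := exists_interval_gt (x := x) (c := min w (min (val hi) e')) (by
          rcases min_choice w (min (val hi) e') with h | h <;> rw [h]
          · exact hw
          · rcases min_choice (val hi) e' with h | h <;> rw [h]
            · exact hhi
            · exact he')
        rw [lt_min_iff, lt_min_iff] at h3
        refine ⟨c, d, h2, (rlt_iff (isReal_toReal d) hzr).2 ?_,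
          (rlt_iff (isReal_toReal d) (isReal_toReal hi)).2 ?_,
          (near_iff hxr (isReal_toReal d) k).2 ⟨e, e', hee, ⟨he, he'⟩, ?_⟩,
          (rlt_iff hxr (isReal_toReal c)).2 ?_⟩
        · rw [cut_toReal]
          exact (ratCut_lt_ratCut.2 h3.1).trans hwz
        · rw [cut_toReal, cut_toReal]
          exact ratCut_lt_ratCut.2 h3.2.1
        · rw [cut_toReal]
          exact ⟨he.trans (h1.trans (ratCut_lt_ratCut.2 h2)), ratCut_lt_ratCut.2 h3.2.2⟩
        · rwa [cut_toReal])
    have key : ∀ k, IsReal (s ⬝ k) ∧ cut (s ⬝ k) < cut z ∧ cut x < cut (s ⬝ k) ∧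
        Near k (s ⬝ k) x ∧ f ⬝ (s ⬝ k) = f ⬝ x := fun k => by
      obtain ⟨c, d, r, ⟨h1, h2, h3, h4⟩, h5, h6, h7⟩ := hs k
      have h1 := (rlt_iff (isReal_toReal d) hzr).1 h1
      have h2 := (rlt_iff (isReal_toReal d) (isReal_toReal hi)).1 h2
      have h4 := (rlt_iff hxr (isReal_toReal c)).1 h4
      rw [cut_toReal] at h1 h4
      rw [cut_toReal, cut_toReal] at h2
      have h8 := h4.trans h6
      exact ⟨h5.isReal_right, h7.trans h1, h8,
        near_of_between hxr h5.isReal_right (isReal_toReal d) h3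
          (.inl ⟨h8.le, h7.le.trans_eq (cut_toReal d).symm⟩),
        hlevel _ r h5 (hlo.trans h8) (h7.trans h2)⟩
    refine ⟨s, fun n => ⟨?_, ?_⟩, convergesTo_of_near hxr (fun n => (key n).1)
      (fun n => (key n).2.2.2.1), fun k => ⟨0, fun n _ => ?_⟩⟩
    · exact hD.convex x hx z hz _ (key n).1 (key n).2.2.1.le (key n).2.1.le
    · exact (rlt_iff hxr (key n).1).2 (key n).2.2.1
    · simp only [(key n).2.2.2.2]
      exact near_refl (hf.isReal_apply hxr) k

/-- The neighbourhoods are intervals whose end-points lie on the level set of `f x`. -/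
theorem peripherallyContinuous : PeripherallyContinuous D f := by
  intro x hx a ha b hb c hc d hd hax hxb hcf hfd
  have hxr := hD.isReal x hx
  rw [rlt_iff ha hxr] at hax
  rw [rlt_iff hxr hb] at hxb
  obtain ⟨lo, hi, hlo, hhi, hlevel⟩ := hf.exists_mem_level hxr
  obtain ⟨u, hu, hau, hux, hfu⟩ : ∃ u, IsReal u ∧ cut a < cut u ∧ cut u < cut x ∧
      f ⬝ u = f ⬝ x := by
    obtain ⟨p, q, h1, h2, h3⟩ := exists_interval_lt (max_lt hax hlo)
    obtain ⟨h4, h5⟩ := max_lt_iff.1 h1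
    obtain ⟨u, hu, h6, h7, h8⟩ := hlevel _ _ h2 (ratCut_lt_ratCut.1 h5).le
      (ratCut_lt_ratCut.1 (h3.trans hhi)).le
    exact ⟨u, hu, h4.trans h6, h7.trans h3, h8⟩
  obtain ⟨v, hv, hvb, hxv, hfv⟩ : ∃ v, IsReal v ∧ cut v < cut b ∧ cut x < cut v ∧
      f ⬝ v = f ⬝ x := by
    obtain ⟨w, hw, hwb⟩ := exists_ratCut_between hxb
    obtain ⟨p, q, h1, h2, h3⟩ := exists_interval_gt (x := x) (c := min w hi) (by
      rcases min_choice w hi with h | h <;> rw [h]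
      · exact hw
      · exact hhi)
    rw [lt_min_iff] at h3
    obtain ⟨v, hv, h6, h7, h8⟩ := hlevel _ _ h2 (ratCut_lt_ratCut.1 (hlo.trans h1)).le h3.2.le
    exact ⟨v, hv, h7.trans ((ratCut_lt_ratCut.2 h3.1).trans hwb), h1.trans h6, h8⟩
  classical
  obtain ⟨W, hW⟩ := exists_fun (M := M) (fun y : M.El one =>
    (if RLT u y ∧ RLT y v then 1 else 0 : M.El nat))
  have hpW : ∀ y, y ∈ points D W ↔ y ∈ D ∧ cut u < cut y ∧ cut y < cut v := fun y => by
    refine and_congr_right fun hy => ?_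
    have hyr := hD.isReal y hy
    rw [hW, rlt_iff hu hyr, rlt_iff hyr hv]
    split_ifs with h
    · exact iff_of_true rfl h
    · exact iff_of_false zero_ne_one h
  have hopen : points D W ⊆ interiorIn D (points D W) := fun y hy => by
    obtain ⟨hyD, huy, hyv⟩ := (hpW y).1 hy
    have hyr := hD.isReal y hyD
    obtain ⟨p, hp, hpy⟩ := exists_ratCut_between huy
    obtain ⟨q, hyq, hq⟩ := exists_ratCut_between hyv
    obtain ⟨k, hk⟩ := exists_near_subset hyr hpy hyq
    refine ⟨hyD, k, fun z hz hyz => (hpW z).2 ⟨hz, ?_⟩⟩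
    obtain ⟨h1, h2⟩ := hk z (hD.isReal z hz) hyz
    exact ⟨hp.trans h1, h2.trans hq⟩
  refine ⟨W, ⟨⟨fun y _ => ?_, fun y hy z hz h => ?_⟩, hopen⟩, (hpW x).2 ⟨hx, hux, hxv⟩,
    fun y hy => ?_, fun y hy => ?_⟩
  · rw [hW]; split_ifs
    · exact .inr rfl
    · exact .inl rfl
  · have hyr := hD.isReal y hy
    have hzr := hD.isReal z hz
    rw [hW, hW, rlt_iff hu hyr, rlt_iff hyr hv, rlt_iff hu hzr, rlt_iff hzr hv,
      (req_iff hyr hzr).1 h]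
  · obtain ⟨hyD, huy, hyv⟩ := (hpW y).1 hy
    have hyr := hD.isReal y hyD
    exact ⟨(rlt_iff ha hyr).2 (hau.trans huy), (rlt_iff hyr hb).2 (hyv.trans hvb)⟩
  · -- a boundary point is equal to one of the end-points `u` and `v`
    obtain ⟨⟨hyD, hcl⟩, hnint⟩ := hy
    have hyr := hD.isReal y hyD
    have huy : cut u ≤ cut y := by
      by_contra hlt
      obtain ⟨p, hp, hpu⟩ := exists_ratCut_between (not_le.1 hlt)
      obtain ⟨q, -, hq, -, -⟩ := hyr.exists_bounds (wt_pos 0)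
      obtain ⟨k, hk⟩ := exists_near_subset hyr hq hp
      obtain ⟨z, hz, hzW, hyz⟩ := hcl k
      exact lt_asymm ((hk z (hD.isReal z hz) hyz).2.trans hpu) ((hpW z).1 hzW).2.1
    have hyv : cut y ≤ cut v := by
      by_contra hlt
      obtain ⟨p, hp, hpy⟩ := exists_ratCut_between (not_le.1 hlt)
      obtain ⟨-, q, -, hq, -⟩ := hyr.exists_bounds (wt_pos 0)
      obtain ⟨k, hk⟩ := exists_near_subset hyr hpy hq
      obtain ⟨z, hz, hzW, hyz⟩ := hcl k
      exact lt_asymm (hp.trans (hk z (hD.isReal z hz) hyz).1) ((hpW z).1 hzW).2.2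
    have hfy : f ⬝ y = f ⬝ x := by
      by_cases h1 : cut u < cut y
      · have h2 : ¬ cut y < cut v := fun h2 => hnint (hopen ((hpW y).2 ⟨hyD, h1, h2⟩))
        rw [hf.congr y v hyr hv (hyv.antisymm (not_lt.1 h2)), hfv]
      · rw [hf.congr y u hyr hu ((not_lt.1 h1).antisymm huy), hfu]
    rw [hfy]
    exact ⟨hcf, hfd⟩

theorem wildNotion_holds (Γ : WildNotion) : Γ.Holds D f := by
  cases Γ
  · exact hf.youngCondition hD
  · exact hf.husainAlmostContinuous hD
  · exact hf.graphContinuous hD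
  · exact hf.not_cesaroType hD
  · exact hf.peripherallyContinuous hD
  · exact hf.preContinuous hD
  · exact hf.cContinuous hD

end IsLocallyTranslationStable

end OneSided

/-! ### `BOOT` from suprema -/

section Reversal

open Frac

variable {M : TypeStructure.{u}} [hM : Fact M.IsACA₀ω]

/-- The `n`-th strip `(1 / (n + 2), 1 / (n + 1))` contains the real number with the cut `S`. -/
def InStrip (n : M.El nat) (S : LowerSet (RatField M)) : Prop :=
  ratCut (val ⟨1, 0, n + 1⟩) < S ∧ S < ratCut (val ⟨1, 0, n⟩)

/-- The irrational number with the cut `S` lies in some strip, the `n`-th, and one of its rational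
translates codes a sequence `h` with `Y (h, n) = 0`. -/
def Hit (Y : M.El (one ⇒ nat ⇒ nat)) (S : LowerSet (RatField M)) : Prop :=
  (∀ c, S ≠ ratCut c) ∧ ∃ n, InStrip n S ∧ ∃ r : Frac M, Y ⬝ decode S (val r) ⬝ n = 0

theorem val_unit (n : M.El nat) : val ⟨1, 0, n⟩ = (toField n + 1)⁻¹ := by
  rw [val, map_one, map_zero, sub_zero, one_div]

theorem val_unit_lt {m n : M.El nat} (h : m < n) : val ⟨1, 0, n⟩ < val ⟨1, 0, m⟩ := by
  rw [val_unit, val_unit]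
  have := den_pos ⟨1, 0, m⟩
  exact inv_strictAnti₀ this (add_lt_add_left (toField_lt.2 h) 1)

theorem InStrip.eq {m n : M.El nat} {S : LowerSet (RatField M)} (h : InStrip m S)
    (h1 : ratCut (val ⟨1, 0, n + 1⟩) ≤ S) (h2 : S ≤ ratCut (val ⟨1, 0, n⟩)) : m = n := by
  have key : ∀ {a b : M.El nat}, a < b → val ⟨1, 0, b⟩ ≤ val ⟨1, 0, a + 1⟩ := fun {a b} hab => by
    rcases ((nat_add_one_le a b).2 hab).eq_or_lt with h | h
    · rw [h]
    · exact (val_unit_lt h).le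
  rcases lt_trichotomy m n with hmn | hmn | hmn
  · exact absurd (h.1.trans_le h2) (ratCut_le_ratCut.2 (key hmn)).not_gt
  · exact hmn
  · exact absurd (h1.trans_lt h.2) (ratCut_le_ratCut.2 (key hmn)).not_gt

theorem inStrip_mem {D : Set (M.El one)} (hD : IsDomainSet D) {x : M.El one} (hx : IsReal x)
    {n : M.El nat} (h1 : ratCut (val ⟨1, 0, n + 1⟩) ≤ cut x)
    (h2 : cut x ≤ ratCut (val ⟨1, 0, n⟩)) : x ∈ D := by
  refine hD.convex _ hD.zero_mem _ hD.one_mem x hx (le_trans ?_ h1) (le_trans h2 ?_)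
  · rw [cut_toReal, ratCut_le_ratCut, val_zero, val_unit]
    exact inv_nonneg.2 (den_pos ⟨1, 0, n + 1⟩).le
  · rw [cut_toReal, ratCut_le_ratCut, val_one, val_unit]
    exact inv_le_one_of_one_le₀ (le_add_of_nonneg_left (toField_nonneg n))

theorem decode_congr {S T : LowerSet (RatField M)} {r t : RatField M}
    (h : ∀ j, DigitOne S r j ↔ DigitOne T t j) : decode S r = decode T t := by
  have e : DigitOne S r = DigitOne T t := funext fun j => propext (h j)
  unfold decode
  generalize DigitOne S r = P at e ⊢
  subst e
  rfl

/-- Being hit is invariant under rational translations inside a strip. -/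
theorem Hit.translate {Y : M.El (one ⇒ nat ⇒ nat)} {x y : M.El one} {t : RatField M}
    (h : IsTranslate x y t) (hx : Hit Y (cut x)) {n : M.El nat} (hn : InStrip n (cut x))
    (hn' : InStrip n (cut y)) : Hit Y (cut y) := by
  obtain ⟨h1, m, hm, r, hr⟩ := hx
  obtain rfl := hm.eq hn.1.le hn.2.le
  obtain ⟨s, hs⟩ := exists_val (val r - t)
  refine ⟨fun c hc => h1 _ ((h.cut_eq c).1 hc), m, hn', s, ?_⟩
  rw [decode_congr (T := cut x) (t := val r) fun j => ?_]
  · exact hr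
  · rw [hs, h.digitOne, sub_add_cancel]

/-- If `Y (h, n) = 0` for some `h`, then the `n`-th strip contains a point that is hit. -/
theorem exists_hit {Y : M.El (one ⇒ nat ⇒ nat)} {h : M.El one} {n : M.El nat}
    (hY : Y ⬝ h ⬝ n = 0) : ∃ x, IsReal x ∧ InStrip n (cut x) ∧ Hit Y (cut x) := by
  obtain ⟨y, hy, hirr, hdec⟩ := exists_irrational_decode h
  obtain ⟨r, h1, h2⟩ := exists_translate_between hy (val_unit_lt (M := M) (m := n) (n := n + 1)
    ((nat_lt_add_one n n).2 le_rfl))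
  obtain ⟨x, hx⟩ := exists_translate hy r
  rw [← hx.lt_cut] at h1
  rw [← hx.cut_lt] at h2
  obtain ⟨s, hs⟩ := exists_val (-r)
  refine ⟨x, hx.isReal_right, ⟨h1, h2⟩, fun c hc => hirr _ ((hx.cut_eq c).1 hc), n, ⟨h1, h2⟩, s, ?_⟩
  rw [decode_eq (g := h) fun i => ?_, hY]
  refine (least_eq ?_ fun v hv => ?_).symm
  · rw [hs, hx.digitOne, neg_add_cancel, hdec _ _ _ rfl]
  · rw [hs, hx.digitOne, neg_add_cancel, hdec _ _ _ rfl]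
    exact hv.ne'

set_option synthInstance.maxHeartbeats 400000 in
/-- The characteristic function of the set of all points that are hit. -/
theorem exists_hit_function (Y : M.El (one ⇒ nat ⇒ nat)) : ∃ f : M.El (one ⇒ one), ∀ x, IsReal x →
    (Hit Y (cut x) → f ⬝ x = toReal 1) ∧ (¬ Hit Y (cut x) → f ⬝ x = toReal 0) := by
  obtain ⟨R, hR⟩ := exists_decoder (M := M)
  obtain ⟨F, hF⟩ := exists_decider (M := M) (fun x => (∀ p : Frac M, ¬ REq x p.toReal) ∧
    ∃ n, (RLT (toReal ⟨1, 0, n + 1⟩) x ∧ RLT x (toReal ⟨1, 0, n⟩)) ∧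
      ∃ r : Frac M, Y ⬝ (R ⬝ x ⬝ r.pos ⬝ r.neg ⬝ r.den) ⬝ n = 0)
  classical
  obtain ⟨f, hf⟩ := exists_fun (M := M) (fun x => M.combK nat nat ⬝
    (if F ⬝ x = 0 then code 1 else code 0))
  have key : ∀ x, IsReal x → (F ⬝ x = 0 ↔ Hit Y (cut x)) := fun x hx => by
    rw [hF]
    refine and_congr ⟨fun h c hc => ?_, fun h p hp => ?_⟩ (exists_congr fun n =>
      and_congr ?_ (exists_congr fun r => ?_))
    · obtain ⟨p, rfl⟩ := exists_val c
      exact h p ((req_iff hx (isReal_toReal p)).2 (hc.trans (cut_toReal p).symm))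
    · exact h _ (((req_iff hx (isReal_toReal p)).1 hp).trans (cut_toReal p))
    · rw [rlt_iff (isReal_toReal _) hx, rlt_iff hx (isReal_toReal _), cut_toReal, cut_toReal]
      rfl
    · rw [hR x hx]
  refine ⟨f, fun x hx => ⟨fun h => ?_, fun h => ?_⟩⟩
  · rw [hf, if_pos ((key x hx).2 h)]; rfl
  · rw [hf, if_neg fun h' => h ((key x hx).1 h')]; rfl

theorem isLocallyTranslationStable_of_hit {Y : M.El (one ⇒ nat ⇒ nat)} {f : M.El (one ⇒ one)}
    (hf : ∀ x, IsReal x → (Hit Y (cut x) → f ⬝ x = toReal 1) ∧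
      (¬ Hit Y (cut x) → f ⬝ x = toReal 0)) : IsLocallyTranslationStable f where
  values x hx := by
    by_cases h : Hit Y (cut x)
    · exact .inr ((hf x hx).1 h)
    · exact .inl ((hf x hx).2 h)
  congr x y hx hy hxy := by
    by_cases h : Hit Y (cut x)
    · rw [(hf x hx).1 h, (hf y hy).1 (hxy ▸ h)]
    · rw [(hf x hx).2 h, (hf y hy).2 (hxy ▸ h)]
  rat x c hx hc := (hf x hx).2 fun h => h.1 c hc
  level x hx := by
    by_cases h : Hit Y (cut x)
    · obtain ⟨-, n, hn, -⟩ := id h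
      refine ⟨x, _, _, hx, hn.1, hn.2, fun y r hy h1 h2 => ?_⟩
      rw [(hf x hx).1 h, (hf y hy.isReal_right).1 (h.translate hy hn ⟨h1, h2⟩)]
    · -- the rationals are the translates of `0`
      obtain ⟨c, d, h1, h2, -⟩ := hx.exists_bounds (wt_pos 0)
      refine ⟨toReal 0, c, d, isReal_toReal 0, h1, h2, fun y r hy _ _ => ?_⟩
      have hyr : cut y = ratCut r := by
        rw [hy.cut_eq, cut_toReal, val_zero, sub_self]
      rw [(hf x hx).2 h, (hf y hy.isReal_right).2 fun h => h.1 r hyr]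

/-- The supremum principle for a class that contains the above functions implies `BOOT`: the
supremum over the closure of the `n`-th strip is positive if and only if `Y (h, n) = 0` for some
`h`. -/
theorem boot_of_supPrinciple {D : Set (M.El one)} (hD : IsDomainSet D)
    {Γ : M.El (one ⇒ one) → Prop} (hΓ : ∀ f, IsLocallyTranslationStable f → Γ f)
    (h : SupPrinciple D Γ) : BOOT M := by
  intro Y
  obtain ⟨f, hf⟩ := exists_hit_function Y
  have hst := isLocallyTranslationStable_of_hit hf
  obtain ⟨t, s, hts⟩ := h f (hst.isFun hD isDomainSet_line) (hΓ f hst)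
  classical
  -- `n` belongs to `X` unless the supremum over the closure of the `n`-th strip is at most `0`
  obtain ⟨X, hX⟩ := exists_fun (M := M) (fun n => (if
    t ⬝ code ⟨1, 0, n + 1⟩ ⬝ code ⟨1, 0, n⟩ = 1 + 1 ∨ (t ⬝ code ⟨1, 0, n + 1⟩ ⬝ code ⟨1, 0, n⟩ = 0 ∧
      RLE (s ⬝ code ⟨1, 0, n + 1⟩ ⬝ code ⟨1, 0, n⟩) (toReal 0)) then 0 else 1 : M.El nat))
  refine ⟨X, fun n => ⟨?_, ?_⟩⟩
  · rw [hX]; split_ifs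
    · exact .inl rfl
    · exact .inr rfl
  have unit_lt := val_unit_lt (M := M) (m := n) (n := n + 1) ((nat_lt_add_one n n).2 le_rfl)
  have hle := ratCut_le_ratCut.2 unit_lt.le
  obtain ⟨hvalid, hub, hleast⟩ := hts ⟨1, 0, n + 1⟩ ⟨1, 0, n⟩
    (inStrip_mem hD (n := n) (isReal_toReal _) (by rw [cut_toReal]) (by rwa [cut_toReal]))
    (inStrip_mem hD (n := n) (isReal_toReal _) (by rwa [cut_toReal]) (by rw [cut_toReal]))
  have hX1 : X ⬝ n = 1 ↔ ¬ (t ⬝ code ⟨1, 0, n + 1⟩ ⬝ code ⟨1, 0, n⟩ = 1 + 1 ∨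
    (t ⬝ code ⟨1, 0, n + 1⟩ ⬝ code ⟨1, 0, n⟩ = 0 ∧
      RLE (s ⬝ code ⟨1, 0, n + 1⟩ ⬝ code ⟨1, 0, n⟩) (toReal 0))) := by
    rw [hX]; split_ifs with h'
    · exact iff_of_false zero_ne_one (not_not.2 h')
    · exact iff_of_true rfl h'
  rw [hX1]
  constructor
  · intro hpos
    by_contra! hne
    refine hpos ?_
    have := hleast ⟨0, toReal 0⟩ (.inl ⟨rfl, isReal_toReal 0⟩) fun x hx hpx hxq => by
      have hxr := hD.isReal x hx
      rw [rle_iff (isReal_toReal _) hxr, cut_toReal] at hpx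
      rw [rle_iff hxr (isReal_toReal _), cut_toReal] at hxq
      have : ¬ Hit Y (cut x) := by
        rintro ⟨-, m, hm, r, hr⟩
        rw [hm.eq hpx hxq] at hr
        exact hne _ hr
      refine .inr (.inr ⟨rfl, rfl, ?_⟩)
      change RLE (f ⬝ x) (toReal 0)
      rw [(hf x hxr).2 this, rle_iff (isReal_toReal 0) (isReal_toReal 0)]
    rcases this with h' | h' | h'
    · exact .inl h'
    · exact absurd (show (0 : M.El nat) = 1 from h') zero_ne_one
    · exact .inr ⟨h'.1, h'.2.2⟩
  · rintro ⟨g, hg⟩ hneg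
    obtain ⟨x, hx, hn, hhit⟩ := exists_hit hg
    have := hub x (inStrip_mem hD hx hn.1.le hn.2.le)
      ((rle_iff (isReal_toReal _) hx).2 (by rw [cut_toReal]; exact hn.1.le))
      ((rle_iff hx (isReal_toReal _)).2 (by rw [cut_toReal]; exact hn.2.le))
    rw [(hf x hx).1 hhit] at this
    rcases hneg with h0 | ⟨h0, h0'⟩
    · rcases this with h' | h' | h'
      · exact absurd (show (0 : M.El nat) = 1 + 1 from h') (by norm_num)
      · exact absurd (h0.symm.trans h') (by norm_num)
      · exact absurd (h0.symm.trans h'.2.1) (by norm_num)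
    · rcases this with h' | h' | ⟨-, -, h'⟩
      · exact absurd (show (0 : M.El nat) = 1 + 1 from h') (by norm_num)
      · exact absurd (h0.symm.trans h') (by norm_num)
      · rcases hvalid with ⟨-, hreal⟩ | h'' | h''
        · have h1 := (rle_iff (isReal_toReal 1) hreal).1 h'
          have h2 := h1.trans ((rle_iff hreal (isReal_toReal 0)).1 h0')
          rw [cut_toReal, cut_toReal, ratCut_le_ratCut, val_zero, val_one] at h2
          exact absurd h2 (not_le.2 one_pos)
        · exact absurd (h0.symm.trans h'') (by norm_num)
        · exact absurd (h0.symm.trans h'') (by norm_num)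

theorem boot_iff_supPrinciple {D : Set (M.El one)} (hD : IsDomainSet D)
    {Γ : M.El (one ⇒ one) → Prop} (hΓ : ∀ f, IsLocallyTranslationStable f → Γ f) :
    BOOT M ↔ SupPrinciple D Γ :=
  ⟨fun h => supPrinciple_of_boot h hD Γ, boot_of_supPrinciple hD hΓ⟩

end Reversal

end HigherOrder

theorem theorem2p10 (M : HigherOrder.TypeStructure.{u}) (hM : M.IsACA₀ω) :
    (HigherOrder.BOOT M ↔
      HigherOrder.SupPrinciple (HigherOrder.Line M) (fun _ => True)) ∧
    (HigherOrder.BOOT M ↔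
      HigherOrder.SupPrinciple (HigherOrder.Line M)
        (fun f => HigherOrder.GraphContinuous (HigherOrder.Line M) f)) ∧
    (HigherOrder.BOOT M ↔
      HigherOrder.SupPrinciple (HigherOrder.UnitInterval M)
        (fun f => HigherOrder.IsFun (HigherOrder.UnitInterval M) (HigherOrder.UnitInterval M) f ∧
          HigherOrder.GraphContinuous (HigherOrder.UnitInterval M) f)) ∧
    (∀ Γ : HigherOrder.WildNotion,
      (HigherOrder.BOOT M ↔
        HigherOrder.SupPrinciple (HigherOrder.Line M)
          (fun f => Γ.Holds (HigherOrder.Line M) f)) ∧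
      (HigherOrder.BOOT M ↔
        HigherOrder.SupPrinciple (HigherOrder.UnitInterval M)
          (fun f => Γ.Holds (HigherOrder.UnitInterval M) f))) := by
  have : Fact M.IsACA₀ω := ⟨hM⟩
  have hL := HigherOrder.isDomainSet_line (M := M)
  have hI := HigherOrder.isDomainSet_unitInterval (M := M)
  exact ⟨HigherOrder.boot_iff_supPrinciple hL fun _ _ => trivial,
    HigherOrder.boot_iff_supPrinciple hL fun _ hf => hf.graphContinuous hL,
    HigherOrder.boot_iff_supPrinciple hI fun _ hf => ⟨hf.isFun hI hI, hf.graphContinuous hI⟩,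
    fun Γ => ⟨HigherOrder.boot_iff_supPrinciple hL fun _ hf => hf.wildNotion_holds hL Γ,
      HigherOrder.boot_iff_supPrinciple hI fun _ hf => hf.wildNotion_holds hI Γ⟩⟩
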